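/- Let $M$ be a compact smooth ($C^\infty$, Hausdorff) manifold without boundary, of dimension $n\ge 0$ (not necessarily connected), and let $f:M\to\mathbb R$ be a Morse function, that is, a $C^2$ function all of whose critical points (points $p$ with $df(p)=0$) are isolated and nondegenerate (the Hessian matrix of $f$ at $p$ in local coordinates is invertible). The index of a critical point is the number, counted with multiplicity, of negative eigenvalues of this Hessian. For $u\in\mathbb R$ let $Z_u=\{x\in M: f(x)=u\}$, let $b_0(Z_u)$ be the number of connected components of $Z_u$, and let $\mathbb S^{n-1}$ be the unit sphere of $\mathbb R^n$ (two points if $n=1$, empty if $n=0$). Let $k\in\{2,3,\dots\}\cup\{\infty\}$ be such that $f$ is of class $C^k$; "diffeomorphic" means $C^k$-diffeomorphic. Then: 1. (Invariance) For all reals $u<v$ such that $f$ has no critical value in $[u,v]$, $Z_u$ is diffeomorphic to $Z_v$. 2. (Change at a critical point) Let $u\in\mathbb R$ and suppose that $Z_u$ contains exactly one critical point $p$ of $f$. Then for all sufficiently small $\varepsilon>0$, $b_0(Z_{u+\varepsilon})$ and $b_0(Z_{u-\varepsilon})$ are finite and $$|b_0(Z_{u+\varepsilon})-b_0(Z_{u-\varepsilon})|\le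 6.$$ 3. (Components diffeomorphic to a sphere) If, in the situation of 2, $p$ has index $0$, then for all sufficiently small $\varepsilon>0$, $Z_{u+\varepsilon}$ is diffeomorphic to the disjoint union $Z_{u-\varepsilon}\sqcup\mathbb S^{n-1}$. -/

import Mathlib

open scoped Manifold ContDiff Topology

namespace MorseLevel

/-- `p` is a critical point of `f`: the differential of `f` vanishes at `p`. -/
def IsCriticalPoint (n : ℕ) {M : Type*} [TopologicalSpace M]
    [ChartedSpace (EuclideanSpace ℝ (Fin n)) M] (f : M → ℝ) (p : M) : Prop :=
  mfderiv (𝓡 n) 𝓘(ℝ, ℝ) f p = 0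

/-- The function `f` read in the preferred coordinates at `p`. -/
noncomputable def inCoordinates (n : ℕ) {M : Type*} [TopologicalSpace M]
    [ChartedSpace (EuclideanSpace ℝ (Fin n)) M] (f : M → ℝ) (p : M) :
    EuclideanSpace ℝ (Fin n) → ℝ :=
  f ∘ (extChartAt (𝓡 n) p).symm

/-- The matrix of second partial derivatives of `f` at `p`, in the preferred coordinates at `p`. -/
noncomputable def hessianMatrix (n : ℕ) {M : Type*} [TopologicalSpace M]
    [ChartedSpace (EuclideanSpace ℝ (Fin n)) M] (f : M → ℝ) (p : M) :
    Matrix (Fin n) (Fin n) ℝ :=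
  Matrix.of fun i j =>
    fderiv ℝ (fderiv ℝ (inCoordinates n f p)) (extChartAt (𝓡 n) p p)
      (EuclideanSpace.single i 1) (EuclideanSpace.single j 1)

/-- The index of a real square matrix: its number of negative eigenvalues, with multiplicity. -/
noncomputable def matrixIndex {n : ℕ} (A : Matrix (Fin n) (Fin n) ℝ) : ℕ :=
  (A.charpoly.roots.filter fun t => t < 0).card

/-- The index of `f` at `p` (meaningful when `p` is a critical point of `f`). -/
noncomputable def morseIndex (n : ℕ) {M : Type*} [TopologicalSpace M]
    [ChartedSpace (EuclideanSpace ℝ (Fin n)) M] (f : M → ℝ) (p : M) : ℕ :=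
  matrixIndex (hessianMatrix n f p)

/-- A Morse function: a `C²` function whose critical points are isolated and nondegenerate. -/
structure IsMorse (n : ℕ) {M : Type*} [TopologicalSpace M]
    [ChartedSpace (EuclideanSpace ℝ (Fin n)) M] (f : M → ℝ) : Prop where
  contMDiff : ContMDiff (𝓡 n) 𝓘(ℝ, ℝ) 2 f
  isolated : ∀ p, IsCriticalPoint n f p →
    ∃ U : Set M, IsOpen U ∧ p ∈ U ∧ ∀ q ∈ U, IsCriticalPoint n f q → q = p
  nondegenerate : ∀ p, IsCriticalPoint n f p → (hessianMatrix n f p).det ≠ 0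

/-- The level set (nodal set) `{f = u}`. -/
def levelSet {M : Type*} (f : M → ℝ) (u : ℝ) : Set M := {x | f x = u}

/-- The number of connected components of a subset of a topological space (meaningful when there
are finitely many of them). -/
noncomputable def b0 {M : Type*} [TopologicalSpace M] (A : Set M) : ℕ :=
  Nat.card (ConnectedComponents A)

/-- A map from a subset `A` of a manifold `M` to a manifold `N` is `C^k` if around every point of
`A` it extends to a `C^k` map on an open subset of `M`. -/
def IsCkOnSubset (m n : ℕ) {M N : Type*}
    [TopologicalSpace M] [ChartedSpace (EuclideanSpace ℝ (Fin m)) M]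
    [TopologicalSpace N] [ChartedSpace (EuclideanSpace ℝ (Fin n)) N]
    (k : ℕ∞) (A : Set M) (g : A → N) : Prop :=
  ∀ x : A, ∃ U : Set M, IsOpen U ∧ (x : M) ∈ U ∧
    ∃ G : M → N, ContMDiffOn (𝓡 m) (𝓡 n) k G U ∧ ∀ y : A, (y : M) ∈ U → G y = g y

/-- The subsets `A ⊆ M` and `B ⊆ N` are `C^k`-diffeomorphic: there is a bijection between them which
is `C^k` together with its inverse. For embedded submanifolds `A` and `B`, this is diffeomorphism of
the submanifolds. -/
def SubsetsDiffeomorphic (m n : ℕ) {M N : Type*}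
    [TopologicalSpace M] [ChartedSpace (EuclideanSpace ℝ (Fin m)) M]
    [TopologicalSpace N] [ChartedSpace (EuclideanSpace ℝ (Fin n)) N]
    (k : ℕ∞) (A : Set M) (B : Set N) : Prop :=
  ∃ e : A ≃ B, IsCkOnSubset m n k A (fun x => (e x : N)) ∧
    IsCkOnSubset n m k B (fun y => (e.symm y : M))

/-- The disjoint union `A ⊔ B` of `A ⊆ M` and `B ⊆ N`, as a subset of the disjoint union of `M` and
`N`. -/
def disjointUnion {M N : Type*} (A : Set M) (B : Set N) : Set (M ⊕ N) :=
  Sum.inl '' A ∪ Sum.inr '' B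

/-- The unit sphere `S^{n-1}` in `ℝⁿ`; two points for `n = 1` and empty for `n = 0`. -/
def unitSphere (n : ℕ) : Set (EuclideanSpace ℝ (Fin n)) := Metric.sphere 0 1

end MorseLevel

/-! The main tool replaces the gradient flow, which for finite `k` would only be of class `C^(k-1)`.
Near a noncritical point `f` is strictly increasing along lines of a fixed direction in a chart.
Sliding a point along its line until a perturbed function takes the old value is a local
diffeomorphism, and the implicit function theorem makes the sliding time `C^k`. Composing one slide
for each member of a partition of unity gives `exists_sweep`: a closed set `s` of noncritical points
has a cutoff `χ`, equal to `1` on `s`, such that for small `ε` a global diffeomorphism carries each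
level of `f` to the same level of `f - ε χ`. On `s` this is the level of `f` higher by `ε`.

Invariance: with `s` a band around a regular level, nearby levels are diffeomorphic, and
connectedness of `[u, v]` finishes.

Change at `p`: with `s` a band minus a small ball about `p`, the level `u - ε` is diffeomorphic to a
set that agrees with the level `u + ε` away from `p`. Close to `p`, `f` is convex along the positive
directions `P` of the Hessian and concave along the negative ones `Q`. A level just above `u` is
therefore a graph over (ball of `Q`) × (unit sphere of `P`), which two connected sets cover.
Components that avoid the ball are shared, so the counts differ by at most 2, well within the stated
6. Replacing `f` by `-f` near `p` handles the levels below `u`.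

Index 0: `P` is the whole space, so the level `u - ε` avoids the ball about `p`, while the level `u
+ ε` meets it in a radial graph over the unit sphere. Outside the ball the sweep identifies the two
levels. -/

namespace MorseLevel
open Set Filter

/-! ### Regularity of crossing times -/

section Crossing

/-- The signs of `F x₀` at two times `a < τ x₀ < b` persist for `x` near `x₀` and trap `τ x` between
`a` and `b`. Only continuity in `x` at each fixed time is needed, not joint continuity. -/
theorem continuousAt_crossing {X : Type*} [TopologicalSpace X] {F : X → ℝ → ℝ} {τ : X → ℝ}
    {α β : ℝ} {x₀ : X} (hτ : τ x₀ ∈ Ioo α β)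
    (hc : ∀ t ∈ Ioo α β, ContinuousAt (fun x => F x t) x₀)
    (hlt : ∀ t ∈ Ioo α β, t < τ x₀ → F x₀ t < 0)
    (hgt : ∀ t ∈ Ioo α β, τ x₀ < t → 0 < F x₀ t)
    (hnear : ∀ᶠ x in 𝓝 x₀, ∀ t ∈ Ioo α β, (F x t < 0 → t < τ x) ∧ (0 < F x t → τ x < t)) :
    ContinuousAt τ x₀ := by
  have key : ∀ l u, l < τ x₀ → τ x₀ < u → ∀ᶠ x in 𝓝 x₀, τ x ∈ Ioo l u := by
    intro l u hl hu
    obtain ⟨a, ha, ha'⟩ := exists_between (max_lt hl hτ.1)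
    obtain ⟨b, hb, hb'⟩ := exists_between (lt_min hu hτ.2)
    have haI : a ∈ Ioo α β := ⟨(le_max_right _ _).trans_lt ha, ha'.trans hτ.2⟩
    have hbI : b ∈ Ioo α β := ⟨hτ.1.trans hb, hb'.trans_le (min_le_right _ _)⟩
    filter_upwards [hnear, (hc a haI).eventually (gt_mem_nhds (hlt a haI ha')),
      (hc b hbI).eventually (lt_mem_nhds (hgt b hbI hb))] with x hx hxa hxb
    exact ⟨((le_max_left _ _).trans_lt ha).trans ((hx a haI).1 hxa),
      ((hx b hbI).2 hxb).trans (hb'.trans_le (min_le_left _ _))⟩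
  rw [ContinuousAt, tendsto_order]
  exact ⟨fun l hl => (key l _ hl (lt_add_one _)).mono fun x hx => hx.1,
    fun u hu => (key _ u (sub_one_lt _) hu).mono fun x hx => hx.2⟩

/-- A continuous solution must coincide near `x₀` with the implicit function, so it inherits its
smoothness. -/
theorem contDiffAt_of_implicit {E : Type*} [NormedAddCommGroup E] [NormedSpace ℝ E]
    [CompleteSpace E] {k : ℕ∞ω} (hk : k ≠ 0) {f : E × ℝ → ℝ} {τ : E → ℝ} {x₀ : E}
    (hf : ContDiffAt ℝ k f (x₀, τ x₀)) (hd : fderiv ℝ f (x₀, τ x₀) (0, 1) ≠ 0)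
    (hτ : ContinuousAt τ x₀) (h : ∀ᶠ x in 𝓝 x₀, f (x, τ x) = f (x₀, τ x₀)) :
    ContDiffAt ℝ k τ x₀ := by
  have hinv : (fderiv ℝ f (x₀, τ x₀) ∘L .inr ℝ E ℝ).IsInvertible := by
    refine ⟨ContinuousLinearEquiv.unitsEquivAut ℝ (Units.mk0 _ hd), ?_⟩
    ext
    simp
  refine (hf.contDiffAt_implicitFunction hk hinv).congr_of_eventuallyEq ?_
  have hpair : Tendsto (fun x => (x, τ x)) (𝓝 x₀) (𝓝 (x₀, τ x₀)) :=
    (continuousAt_id.prodMk hτ)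
  filter_upwards [h, hpair.eventually (hf.eventually_apply_eq_iff_implicitFunction hk hinv)]
    with x hx hx'
  exact (hx'.1 hx).symm

end Crossing

section Lines

variable {E : Type*} [NormedAddCommGroup E] [NormedSpace ℝ E]

theorem hasDerivAt_line {G : E → ℝ} {x V : E} {t : ℝ} (h : DifferentiableAt ℝ G (x + t • V)) :
    HasDerivAt (fun s : ℝ => G (x + s • V)) (fderiv ℝ G (x + t • V) V) t := by
  have h1 : HasDerivAt (fun s : ℝ => x + s • V) V t := by
    simpa using ((hasDerivAt_id t).smul_const V).const_add x
  exact h.hasFDerivAt.comp_hasDerivAt t h1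

theorem strictMonoOn_line {G : E → ℝ} {x V : E} {a b : ℝ}
    (hd : ∀ t ∈ Icc a b, DifferentiableAt ℝ G (x + t • V))
    (hpos : ∀ t ∈ Icc a b, 0 < fderiv ℝ G (x + t • V) V) :
    StrictMonoOn (fun t : ℝ => G (x + t • V)) (Icc a b) := by
  refine strictMonoOn_of_deriv_pos (convex_Icc a b)
    (fun t ht => (hasDerivAt_line (hd t ht)).continuousAt.continuousWithinAt) fun t ht => ?_
  have ht' := interior_subset ht
  rw [(hasDerivAt_line (hd t ht')).deriv]
  exact hpos t ht'

/-- Moving along lines of direction `V`, along which `G'` is strictly increasing, one reaches any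
prescribed intermediate value of `G'` at a unique time, which depends `C^k` on the data. -/
theorem exists_lineTime [CompleteSpace E] {G G' : E → ℝ} {V : E} {r : ℝ} (hr : 0 < r)
    {S : Set E} (hS : IsOpen S)
    (hc : ∀ x ∈ S, ∀ t ∈ Icc (-r) r, ContDiffAt ℝ 1 G' (x + t • V))
    (hpos : ∀ x ∈ S, ∀ t ∈ Icc (-r) r, 0 < fderiv ℝ G' (x + t • V) V)
    (hlt : ∀ x ∈ S, G' (x + (-r) • V) < G x) (hgt : ∀ x ∈ S, G x < G' (x + r • V)) :
    ∃ τ : E → ℝ, (∀ x ∈ S, τ x ∈ Ioo (-r) r ∧ G' (x + τ x • V) = G x ∧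
      ∀ t ∈ Icc (-r) r, G' (x + t • V) = G x → t = τ x) ∧
      (ContinuousOn G S → ContinuousOn τ S) ∧
      ∀ k : ℕ∞ω, k ≠ 0 → ContDiffOn ℝ k G S →
        (∀ x ∈ S, ∀ t ∈ Icc (-r) r, ContDiffAt ℝ k G' (x + t • V)) → ContDiffOn ℝ k τ S := by
  have hmono : ∀ x ∈ S, StrictMonoOn (fun t : ℝ => G' (x + t • V)) (Icc (-r) r) := fun x hx =>
    strictMonoOn_line (fun t ht => (hc x hx t ht).differentiableAt one_ne_zero) (hpos x hx)
  have hex : ∀ x ∈ S, ∃ t ∈ Ioo (-r) r, G' (x + t • V) = G x := by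
    intro x hx
    have hcont : ContinuousOn (fun t : ℝ => G' (x + t • V)) (Icc (-r) r) := fun t ht =>
      (hasDerivAt_line ((hc x hx t ht).differentiableAt
        one_ne_zero)).continuousAt.continuousWithinAt
    exact intermediate_value_Ioo (by linarith) hcont ⟨hlt x hx, hgt x hx⟩
  choose! τ hτ hτG using hex
  have hcτ : ContinuousOn G S → ContinuousOn τ S := by
    intro hG x₀ hx₀
    refine ContinuousAt.continuousWithinAt ?_
    refine continuousAt_crossing (F := fun x t => G' (x + t • V) - G x) (hτ x₀ hx₀) ?_ ?_ ?_ ?_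
    · intro t ht
      refine ContinuousAt.sub ?_ (hG.continuousAt (hS.mem_nhds hx₀))
      refine ContinuousAt.comp (f := fun x => x + t • V)
        (hc x₀ hx₀ t (Ioo_subset_Icc_self ht)).continuousAt (by fun_prop)
    · intro t ht hlt
      have := hmono x₀ hx₀ (Ioo_subset_Icc_self ht) (Ioo_subset_Icc_self (hτ x₀ hx₀)) hlt
      simp only [hτG x₀ hx₀] at this
      linarith
    · intro t ht hlt
      have := hmono x₀ hx₀ (Ioo_subset_Icc_self (hτ x₀ hx₀)) (Ioo_subset_Icc_self ht) hlt
      simp only [hτG x₀ hx₀] at this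
      linarith
    · filter_upwards [hS.mem_nhds hx₀] with x hx t ht
      have hm := (hmono x hx).lt_iff_lt (Ioo_subset_Icc_self ht) (Ioo_subset_Icc_self (hτ x hx))
      have hm' := (hmono x hx).lt_iff_lt (Ioo_subset_Icc_self (hτ x hx)) (Ioo_subset_Icc_self ht)
      simp only [hτG x hx] at hm hm'
      exact ⟨fun h => hm.1 (by linarith), fun h => hm'.1 (by linarith)⟩
  refine ⟨τ, fun x hx => ⟨hτ x hx, hτG x hx, fun t ht h => ?_⟩, hcτ, fun k hk hG hG' x₀ hx₀ => ?_⟩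
  · exact (hmono x hx).injOn ht (Ioo_subset_Icc_self (hτ x hx)) (h.trans (hτG x hx).symm)
  · refine ContDiffAt.contDiffWithinAt ?_
    have hm := hG' x₀ hx₀ _ (Ioo_subset_Icc_self (hτ x₀ hx₀))
    have hGx := hG.contDiffAt (hS.mem_nhds hx₀)
    have hf : ContDiffAt ℝ k (fun p : E × ℝ => G' (p.1 + p.2 • V) - G p.1) (x₀, τ x₀) := by
      refine ContDiffAt.sub ?_ ?_
      · exact ContDiffAt.comp (x₀, τ x₀) (f := fun p : E × ℝ => p.1 + p.2 • V) hm
          (by fun_prop)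
      · exact ContDiffAt.comp (x₀, τ x₀) (f := fun p : E × ℝ => p.1) hGx (by fun_prop)
    refine contDiffAt_of_implicit hk hf ?_
      ((hcτ hG.continuousOn).continuousAt (hS.mem_nhds hx₀)) ?_
    · have h1 : HasDerivAt (fun s : ℝ => ((x₀, s) : E × ℝ)) (0, 1) (τ x₀) :=
        (hasDerivAt_const _ _).prodMk (hasDerivAt_id _)
      have h2 := (hf.differentiableAt hk).hasFDerivAt.comp_hasDerivAt _ h1
      have h3 := (hasDerivAt_line (hm.differentiableAt hk)).sub_const (G x₀)
      have := h2.unique h3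
      rw [this]
      exact (hpos x₀ hx₀ _ (Ioo_subset_Icc_self (hτ x₀ hx₀))).ne'
    · filter_upwards [hS.mem_nhds hx₀] with x hx
      simp only [hτG x hx, hτG x₀ hx₀, sub_self]

end Lines
end MorseLevel

/-! ### Sliding points along lines in one chart -/

namespace MorseLevel
open Set Filter Metric

variable {n : ℕ} {M : Type*} [TopologicalSpace M]
  [ChartedSpace (EuclideanSpace ℝ (Fin n)) M]

/-- The ball of radius `r` about `q` in the preferred coordinates at `q`. -/
def chartBall (n : ℕ) {M : Type*} [TopologicalSpace M]
    [ChartedSpace (EuclideanSpace ℝ (Fin n)) M] (q : M) (r : ℝ) : Set M :=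
  (extChartAt (𝓡 n) q).source ∩ extChartAt (𝓡 n) q ⁻¹' ball (extChartAt (𝓡 n) q q) r

/-- The closed ball of radius `r` about `q` in the preferred coordinates at `q`. -/
def chartClosedBall (n : ℕ) {M : Type*} [TopologicalSpace M]
    [ChartedSpace (EuclideanSpace ℝ (Fin n)) M] (q : M) (r : ℝ) : Set M :=
  (extChartAt (𝓡 n) q).source ∩ extChartAt (𝓡 n) q ⁻¹' closedBall (extChartAt (𝓡 n) q q) r

theorem isOpen_chartBall (q : M) (r : ℝ) : IsOpen (chartBall n q r) :=
  (continuousOn_extChartAt q).isOpen_inter_preimage (isOpen_extChartAt_source q) isOpen_ball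

theorem mem_chartBall_self (q : M) {r : ℝ} (hr : 0 < r) : q ∈ chartBall n q r :=
  ⟨mem_extChartAt_source q, mem_ball_self hr⟩

theorem chartBall_subset_chartBall (q : M) {r s : ℝ} (h : r ≤ s) :
    chartBall n q r ⊆ chartBall n q s := fun _ hx => ⟨hx.1, ball_subset_ball h hx.2⟩

theorem chartClosedBall_subset_chartBall (q : M) {r s : ℝ} (h : r < s) :
    chartClosedBall n q r ⊆ chartBall n q s := fun _ hx => ⟨hx.1, closedBall_subset_ball h hx.2⟩

theorem chartBall_subset_chartClosedBall (q : M) (r : ℝ) :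
    chartBall n q r ⊆ chartClosedBall n q r := fun _ hx => ⟨hx.1, ball_subset_closedBall hx.2⟩

theorem isCompact_chartClosedBall (q : M) {r : ℝ}
    (h : closedBall (extChartAt (𝓡 n) q q) r ⊆ (extChartAt (𝓡 n) q).target) :
    IsCompact (chartClosedBall n q r) := by
  have : chartClosedBall n q r =
      (extChartAt (𝓡 n) q).symm '' closedBall (extChartAt (𝓡 n) q q) r :=
    ((extChartAt (𝓡 n) q).symm_image_eq_source_inter_preimage h).symm
  rw [this]
  exact (isCompact_closedBall _ _).image_of_continuousOn ((continuousOn_extChartAt_symm q).mono h)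

theorem exists_closedBall_subset_target (q : M) :
    ∃ r > 0, closedBall (extChartAt (𝓡 n) q q) r ⊆ (extChartAt (𝓡 n) q).target :=
  nhds_basis_closedBall.mem_iff.1 ((isOpen_extChartAt_target q).mem_nhds (mem_extChartAt_target q))

theorem inCoordinates_apply {f : M → ℝ} {q x : M} (hx : x ∈ (extChartAt (𝓡 n) q).source) :
    inCoordinates n f q (extChartAt (𝓡 n) q x) = f x := by
  simp only [inCoordinates, Function.comp_apply, (extChartAt (𝓡 n) q).left_inv hx]

theorem inCoordinates_self (f : M → ℝ) (q : M) :
    inCoordinates n f q (extChartAt (𝓡 n) q q) = f q :=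
  inCoordinates_apply (mem_extChartAt_source q)

theorem isCriticalPoint_iff {f : M → ℝ} (hf : ContMDiff (𝓡 n) 𝓘(ℝ, ℝ) 1 f) (q : M) :
    IsCriticalPoint n f q ↔
      fderiv ℝ (inCoordinates n f q) (extChartAt (𝓡 n) q q) = 0 := by
  have h := (hf.mdifferentiable one_ne_zero q).mfderiv
  simp only [writtenInExtChartAt, extChartAt_model_space_eq_id, PartialEquiv.refl_coe,
    Function.id_comp, modelWithCornersSelf_coe, range_id, fderivWithin_univ] at h
  unfold IsCriticalPoint
  rw [h]
  rfl

section Coordinates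

variable [IsManifold (𝓡 n) ∞ M]

theorem isManifold_of_natInf (k : ℕ∞) : IsManifold (𝓡 n) k M :=
  IsManifold.of_le (n := ∞) (by exact_mod_cast le_top)

theorem contDiffOn_inCoordinates {k : ℕ∞} {f : M → ℝ} (hf : ContMDiff (𝓡 n) 𝓘(ℝ, ℝ) k f) (q : M) :
    ContDiffOn ℝ k (inCoordinates n f q) (extChartAt (𝓡 n) q).target := by
  have := isManifold_of_natInf (n := n) (M := M) k
  rw [← contMDiffOn_iff_contDiffOn]
  exact hf.comp_contMDiffOn (contMDiffOn_extChartAt_symm q)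

theorem contDiffAt_inCoordinates {k : ℕ∞} {f : M → ℝ} (hf : ContMDiff (𝓡 n) 𝓘(ℝ, ℝ) k f) {q : M}
    {z : EuclideanSpace ℝ (Fin n)} (hz : z ∈ (extChartAt (𝓡 n) q).target) :
    ContDiffAt ℝ k (inCoordinates n f q) z :=
  (contDiffOn_inCoordinates hf q).contDiffAt ((isOpen_extChartAt_target q).mem_nhds hz)

end Coordinates

/-- In the preferred coordinates at `q`, on a closed ball of radius `3 r`, the function `f` has
positive derivative in the direction of the vector `V`. -/
structure IsLineChart (f : M → ℝ) (q : M) (r : ℝ) (V : EuclideanSpace ℝ (Fin n)) : Prop where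
  pos : 0 < r
  norm_le : ‖V‖ ≤ 1
  subset_target : closedBall (extChartAt (𝓡 n) q q) (3 * r) ⊆ (extChartAt (𝓡 n) q).target
  deriv_pos : ∀ z ∈ closedBall (extChartAt (𝓡 n) q q) (3 * r),
    0 < fderiv ℝ (inCoordinates n f q) z V

theorem exists_isLineChart [IsManifold (𝓡 n) ∞ M] {f : M → ℝ}
    (hf : ContMDiff (𝓡 n) 𝓘(ℝ, ℝ) 1 f) {q : M} (hq : ¬ IsCriticalPoint n f q) :
    ∃ (r : ℝ) (V : EuclideanSpace ℝ (Fin n)), IsLineChart f q r V := by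
  rw [isCriticalPoint_iff hf] at hq
  obtain ⟨V, hV⟩ : ∃ V, 0 < fderiv ℝ (inCoordinates n f q) (extChartAt (𝓡 n) q q) V := by
    by_contra! h
    refine hq (ContinuousLinearMap.ext fun v => le_antisymm (h v) ?_)
    have := h (-v)
    simpa using this
  have hf' : ContMDiff (𝓡 n) 𝓘(ℝ, ℝ) (1 : ℕ∞) f := hf
  have hcont : ContinuousAt (fun z => fderiv ℝ (inCoordinates n f q) z V)
      (extChartAt (𝓡 n) q q) :=
    (((contDiffAt_inCoordinates hf' (mem_extChartAt_target q)).fderiv_right (m := 0)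
      (by simp)).continuousAt).clm_apply continuousAt_const
  obtain ⟨r, hr, hsub⟩ := nhds_basis_closedBall.mem_iff.1
    (inter_mem ((isOpen_extChartAt_target (I := 𝓡 n) q).mem_nhds (mem_extChartAt_target q))
      (hcont.eventually (lt_mem_nhds hV)))
  have hV0 : 0 < ‖V‖ := norm_pos_iff.2 (by rintro rfl; simp at hV)
  refine ⟨r / 3, ‖V‖⁻¹ • V, by positivity, ?_, ?_, ?_⟩
  · rw [norm_smul, norm_inv, norm_norm, inv_mul_cancel₀ hV0.ne']
  · rw [mul_div_cancel₀ _ (by norm_num)]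
    exact fun z hz => (hsub hz).1
  · rw [mul_div_cancel₀ _ (by norm_num)]
    intro z hz
    have : 0 < fderiv ℝ (inCoordinates n f q) z V := (hsub hz).2
    rw [map_smul, smul_eq_mul]
    positivity

theorem IsLineChart.add_smul_mem {f : M → ℝ} {q : M} {r : ℝ} {V : EuclideanSpace ℝ (Fin n)}
    (h : IsLineChart f q r V) {z : EuclideanSpace ℝ (Fin n)} {a t : ℝ}
    (hz : z ∈ ball (extChartAt (𝓡 n) q q) a) (ht : t ∈ Icc (-r) r) :
    z + t • V ∈ ball (extChartAt (𝓡 n) q q) (a + r) := by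
  rw [mem_ball, dist_eq_norm] at hz ⊢
  have h1 : ‖t • V‖ ≤ r := by
    rw [norm_smul]
    calc ‖t‖ * ‖V‖ ≤ r * 1 :=
          mul_le_mul (abs_le.2 ht) h.norm_le (norm_nonneg _) h.pos.le
      _ = r := mul_one r
  calc ‖z + t • V - extChartAt (𝓡 n) q q‖ = ‖(z - extChartAt (𝓡 n) q q) + t • V‖ := by
        congr 1; abel
    _ ≤ ‖z - extChartAt (𝓡 n) q q‖ + ‖t • V‖ := norm_add_le _ _
    _ < a + r := by linarith

/-- Moving points along lines in a chart so that the values of `g` become values of `g'`. -/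
theorem exists_move [T2Space M] [IsManifold (𝓡 n) ∞ M] {k : ℕ∞} (hk : 1 ≤ k) {g g' : M → ℝ}
    (hg : ContMDiff (𝓡 n) 𝓘(ℝ, ℝ) k g) (hg' : ContMDiff (𝓡 n) 𝓘(ℝ, ℝ) k g')
    {q : M} {r : ℝ} {V : EuclideanSpace ℝ (Fin n)} (h : IsLineChart g' q r V)
    (heq : ∀ x ∉ chartBall n q r, g' x = g x)
    (hlt : ∀ x ∈ ball (extChartAt (𝓡 n) q q) (2 * r),
      inCoordinates n g' q (x + (-r) • V) < inCoordinates n g q x)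
    (hgt : ∀ x ∈ ball (extChartAt (𝓡 n) q q) (2 * r),
      inCoordinates n g q x < inCoordinates n g' q (x + r • V)) :
    ∃ e : M → M, ContMDiff (𝓡 n) (𝓡 n) k e ∧ (∀ x, g' (e x) = g x) ∧
      (∀ x ∉ chartBall n q r, e x = x) ∧
      ∀ x ∈ chartBall n q (2 * r), ∃ t ∈ Icc (-r) r,
        e x = (extChartAt (𝓡 n) q).symm (extChartAt (𝓡 n) q x + t • V) ∧
        ∀ s ∈ Icc (-r) r, inCoordinates n g' q (extChartAt (𝓡 n) q x + s • V) = g x → s = t := by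
  have hM := isManifold_of_natInf (n := n) (M := M) k
  set φ := extChartAt (𝓡 n) q with hφ
  have hk0 : (k : ℕ∞ω) ≠ 0 := by
    have : k ≠ 0 := fun h0 => by simp [h0] at hk
    exact_mod_cast this
  have hk1 : ((1 : ℕ∞) : ℕ∞ω) ≤ k := by exact_mod_cast hk
  have hr := h.pos
  have hin : ∀ z ∈ ball (φ q) (2 * r), ∀ t ∈ Icc (-r) r,
      z + t • V ∈ closedBall (φ q) (3 * r) := fun z hz t ht =>
    ball_subset_closedBall (by convert! h.add_smul_mem hz ht using 2; ring)
  obtain ⟨τ, hτ, -, hτk⟩ := exists_lineTime (G := inCoordinates n g q) (G' := inCoordinates n g' q)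
    hr (isOpen_ball (x := φ q) (ε := 2 * r))
    (fun z hz t ht => (contDiffAt_inCoordinates hg'
      (h.subset_target (hin z hz t ht))).of_le hk1)
    (fun z hz t ht => h.deriv_pos _ (hin z hz t ht)) hlt hgt
  have hsub2 : ball (φ q) (2 * r) ⊆ φ.target := fun z hz => h.subset_target
    (ball_subset_closedBall (ball_subset_ball (by linarith) hz))
  have hτs := hτk k hk0 ((contDiffOn_inCoordinates hg q).mono hsub2)
    (fun z hz t ht => contDiffAt_inCoordinates hg' (h.subset_target (hin z hz t ht)))
  -- Where `g` and `g'` agree, time `0` solves the equation, and solutions are unique.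
  have hzero : ∀ x ∈ chartBall n q (2 * r), x ∉ chartBall n q r → τ (φ x) = 0 := by
    intro x hx hx'
    refine ((hτ _ hx.2).2.2 0 ⟨by linarith, hr.le⟩ ?_).symm
    rw [zero_smul, add_zero, inCoordinates_apply hx.1, inCoordinates_apply hx.1, heq x hx']
  classical
  -- Both formulas give the identity between radii `r` and `2 r`, so `e` is smooth across the seam.
  -- Lines starting within `2 r` stay within `3 r`, where the derivative is controlled.
  let e : M → M := fun x => if x ∈ chartBall n q (2 * r) then φ.symm (φ x + τ (φ x) • V) else x
  have he2 : ∀ x ∈ chartBall n q (2 * r), e x = φ.symm (φ x + τ (φ x) • V) := fun x hx => if_pos hx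
  have he1 : ∀ x ∉ chartBall n q r, e x = x := by
    intro x hx
    by_cases hx2 : x ∈ chartBall n q (2 * r)
    · rw [he2 x hx2, hzero x hx2 hx, zero_smul, add_zero, φ.left_inv hx2.1]
    · exact if_neg hx2
  refine ⟨e, ?_, ?_, he1, ?_⟩
  · intro x
    by_cases hx : x ∈ chartBall n q (2 * r)
    · have hx' := (isOpen_chartBall q (2 * r)).mem_nhds hx
      refine ContMDiffAt.congr_of_eventuallyEq ?_ (Filter.eventually_of_mem hx' he2)
      have h1 : ContMDiffAt (𝓡 n) 𝓘(ℝ, EuclideanSpace ℝ (Fin n)) k φ x :=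
        contMDiffAt_extChartAt' (by simpa [hφ] using hx.1)
      have h2 : ContDiffAt ℝ k (fun z => z + τ z • V) (φ x) :=
        contDiffAt_id.add ((hτs.contDiffAt (isOpen_ball.mem_nhds hx.2)).smul contDiffAt_const)
      have h3 : ContMDiffAt 𝓘(ℝ, EuclideanSpace ℝ (Fin n)) (𝓡 n) k φ.symm
          (φ x + τ (φ x) • V) :=
        (contMDiffOn_extChartAt_symm q).contMDiffAt ((isOpen_extChartAt_target q).mem_nhds
          (h.subset_target (hin _ hx.2 _ (Ioo_subset_Icc_self (hτ _ hx.2).1))))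
      exact h3.comp x (ContMDiffAt.comp (I' := 𝓘(ℝ, EuclideanSpace ℝ (Fin n)))
        (g := fun z => z + τ z • V) x h2.contMDiffAt h1)
    · have hcl : IsClosed (chartClosedBall n q r) :=
        (isCompact_chartClosedBall q ((closedBall_subset_closedBall (by linarith)).trans
          h.subset_target)).isClosed
      have hx' : x ∉ chartClosedBall n q r :=
        fun hx' => hx (chartClosedBall_subset_chartBall q (by linarith) hx')
      refine ContMDiffAt.congr_of_eventuallyEq contMDiffAt_id
        (Filter.eventually_of_mem (hcl.isOpen_compl.mem_nhds hx') fun y hy => ?_)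
      exact he1 y fun hy' => hy (chartBall_subset_chartClosedBall q r hy')
  · intro x
    by_cases hx : x ∈ chartBall n q (2 * r)
    · rw [he2 x hx, ← inCoordinates_apply (f := g) hx.1]
      exact (hτ _ hx.2).2.1
    · have : x ∉ chartBall n q r := fun h' => hx (chartBall_subset_chartBall q (by linarith) h')
      rw [he1 x this, heq x this]
  · intro x hx
    refine ⟨τ (φ x), Ioo_subset_Icc_self (hτ _ hx.2).1, he2 x hx, fun s hs hsx => ?_⟩
    exact (hτ _ hx.2).2.2 s hs (by rw [hsx, inCoordinates_apply hx.1])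

/-- The slide from `g` to `g'` and the slide from `g'` to `g` follow the same lines, so uniqueness
of the times makes them mutually inverse. -/
theorem exists_diffeomorph_of_isLineChart [T2Space M] [IsManifold (𝓡 n) ∞ M] {k : ℕ∞} (hk : 1 ≤ k)
    {g g' : M → ℝ}
    (hg : ContMDiff (𝓡 n) 𝓘(ℝ, ℝ) k g) (hg' : ContMDiff (𝓡 n) 𝓘(ℝ, ℝ) k g')
    {q : M} {r : ℝ} {V : EuclideanSpace ℝ (Fin n)} (h : IsLineChart g q r V)
    (h' : IsLineChart g' q r V) (heq : ∀ x ∉ chartBall n q r, g' x = g x)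
    (hlt : ∀ x ∈ ball (extChartAt (𝓡 n) q q) (2 * r),
      inCoordinates n g' q (x + (-r) • V) < inCoordinates n g q x)
    (hgt : ∀ x ∈ ball (extChartAt (𝓡 n) q q) (2 * r),
      inCoordinates n g q x < inCoordinates n g' q (x + r • V))
    (hlt' : ∀ x ∈ ball (extChartAt (𝓡 n) q q) (2 * r),
      inCoordinates n g q (x + (-r) • V) < inCoordinates n g' q x)
    (hgt' : ∀ x ∈ ball (extChartAt (𝓡 n) q q) (2 * r),
      inCoordinates n g' q x < inCoordinates n g q (x + r • V)) :
    ∃ Φ : M ≃ₘ^k⟮𝓡 n, 𝓡 n⟯ M, ∀ x, g' (Φ x) = g x := by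
  have hr := h.pos
  obtain ⟨e, hek, heg, heid, het⟩ := exists_move hk hg hg' h' heq hlt hgt
  obtain ⟨e', hek', heg', heid', het'⟩ := exists_move hk hg' hg h
    (fun x hx => (heq x hx).symm) hlt' hgt'
  have key : ∀ {g g' : M → ℝ} {e e' : M → M}, (IsLineChart g' q r V) →
      (∀ x, g' (e x) = g x) → (∀ x ∉ chartBall n q r, e x = x) →
      (∀ x ∉ chartBall n q r, e' x = x) →
      (∀ x ∈ chartBall n q (2 * r), ∃ t ∈ Icc (-r) r,
        e x = (extChartAt (𝓡 n) q).symm (extChartAt (𝓡 n) q x + t • V)) →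
      (∀ x ∈ chartBall n q (2 * r), ∃ t ∈ Icc (-r) r,
        e' x = (extChartAt (𝓡 n) q).symm (extChartAt (𝓡 n) q x + t • V) ∧
        ∀ s ∈ Icc (-r) r, inCoordinates n g q (extChartAt (𝓡 n) q x + s • V) = g' x → s = t) →
      ∀ x, e' (e x) = x := by
    intro g g' e e' h' heg heid heid' het het' x
    by_cases hx : x ∈ chartBall n q r
    · obtain ⟨t, ht, hext⟩ := het x (chartBall_subset_chartBall q (by linarith) hx)
      have hball := h'.add_smul_mem hx.2 ht
      rw [← two_mul] at hball
      have htarget : extChartAt (𝓡 n) q x + t • V ∈ (extChartAt (𝓡 n) q).target :=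
        h'.subset_target (ball_subset_closedBall (ball_subset_ball (by linarith) hball))
      have hφ : extChartAt (𝓡 n) q (e x) = extChartAt (𝓡 n) q x + t • V := by
        rw [hext, (extChartAt (𝓡 n) q).right_inv htarget]
      have hex : e x ∈ chartBall n q (2 * r) :=
        ⟨by rw [hext]; exact (extChartAt (𝓡 n) q).map_target htarget, by
          rw [mem_preimage, hφ]; exact hball⟩
      obtain ⟨s, hs, hes, huniq⟩ := het' (e x) hex
      -- Going back by `-t` restores the original value, so it is the unique admissible return time.
      have : -t = s := by
        refine huniq (-t) ⟨by linarith [ht.2], by linarith [ht.1]⟩ ?_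
        rw [hφ, neg_smul, add_neg_cancel_right, inCoordinates_apply hx.1, heg]
      rw [hes, hφ, ← this, neg_smul, add_neg_cancel_right, (extChartAt (𝓡 n) q).left_inv hx.1]
    · rw [heid x hx, heid' x hx]
  refine ⟨⟨⟨e, e', key h' heg heid heid' ?_ het', key h heg' heid' heid ?_ het⟩, hek, hek'⟩, heg⟩
  · intro x hx
    obtain ⟨t, ht, h1, -⟩ := het x hx
    exact ⟨t, ht, h1⟩
  · intro x hx
    obtain ⟨t, ht, h1, -⟩ := het' x hx
    exact ⟨t, ht, h1⟩

end MorseLevel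

/-! ### Global sweeping diffeomorphisms -/

namespace MorseLevel
open Set Filter Metric

variable {n : ℕ} {M : Type*} [TopologicalSpace M]
  [ChartedSpace (EuclideanSpace ℝ (Fin n)) M]

/-- This adds a single bump `ρ`, supported in one line chart, to the perturbation `η` already
treated. For small `ε` the perturbed functions still increase along the lines of that chart. -/
theorem exists_diffeomorph_step [T2Space M] [IsManifold (𝓡 n) ∞ M] {k : ℕ∞} (hk : 1 ≤ k)
    {f η ρ : M → ℝ} (hf : ContMDiff (𝓡 n) 𝓘(ℝ, ℝ) k f) (hη : ContMDiff (𝓡 n) 𝓘(ℝ, ℝ) k η)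
    (hρ : ContMDiff (𝓡 n) 𝓘(ℝ, ℝ) k ρ) {q : M} {r : ℝ} {V : EuclideanSpace ℝ (Fin n)}
    (h : IsLineChart f q r V) (hsupp : ∀ x ∉ chartBall n q r, ρ x = 0) :
    ∃ ε₀ > 0, ∀ ε : ℝ, |ε| < ε₀ → ∃ Φ : M ≃ₘ^k⟮𝓡 n, 𝓡 n⟯ M,
      ∀ x, f (Φ x) - ε * (η (Φ x) + ρ (Φ x)) = f x - ε * η x := by
  have hr := h.pos
  have hk1 : ((1 : ℕ∞) : ℕ∞ω) ≤ k := by exact_mod_cast hk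
  have hcoe : (0 : ℕ∞ω) + 1 ≤ k := by simpa using hk1
  set K := closedBall (extChartAt (𝓡 n) q q) (3 * r) with hKdef
  have hK : IsCompact K := isCompact_closedBall _ _
  have hcd : ∀ {g : M → ℝ}, ContMDiff (𝓡 n) 𝓘(ℝ, ℝ) k g → ∀ z ∈ K,
      ContDiffAt ℝ k (inCoordinates n g q) z :=
    fun hg z hz => contDiffAt_inCoordinates hg (h.subset_target hz)
  have hdiff : ∀ {g : M → ℝ}, ContMDiff (𝓡 n) 𝓘(ℝ, ℝ) k g → ∀ z ∈ K,
      DifferentiableAt ℝ (inCoordinates n g q) z :=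
    fun hg z hz => ((hcd hg z hz).of_le hk1).differentiableAt one_ne_zero
  have hcont : ∀ {g : M → ℝ}, ContMDiff (𝓡 n) 𝓘(ℝ, ℝ) k g →
      ContinuousOn (inCoordinates n g q) K :=
    fun hg z hz => (hcd hg z hz).continuousAt.continuousWithinAt
  have hdcont : ∀ {g : M → ℝ}, ContMDiff (𝓡 n) 𝓘(ℝ, ℝ) k g →
      ContinuousOn (fun z => fderiv ℝ (inCoordinates n g q) z V) K := fun hg z hz =>
    ((((hcd hg z hz).fderiv_right hcoe).continuousAt).clm_apply
      continuousAt_const).continuousWithinAt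
  have hbd : ∀ {g : M → ℝ}, ContMDiff (𝓡 n) 𝓘(ℝ, ℝ) k g → ∃ C, ∀ z ∈ K,
      |inCoordinates n g q z| ≤ C ∧ |fderiv ℝ (inCoordinates n g q) z V| ≤ C := by
    intro g hg
    obtain ⟨C₁, hC₁⟩ := hK.exists_bound_of_continuousOn (hcont hg)
    obtain ⟨C₂, hC₂⟩ := hK.exists_bound_of_continuousOn (hdcont hg)
    exact ⟨max C₁ C₂, fun z hz => ⟨(hC₁ z hz).trans (le_max_left _ _),
      (hC₂ z hz).trans (le_max_right _ _)⟩⟩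
  have hmem : ∀ t ∈ Icc (-r) r, ∀ z ∈ ball (extChartAt (𝓡 n) q q) (2 * r), z + t • V ∈ K :=
    fun t ht z hz => ball_subset_closedBall (by convert! h.add_smul_mem hz ht using 2; ring)
  have hrI : r ∈ Icc (-r) r := ⟨by linarith, le_rfl⟩
  have hrI' : -r ∈ Icc (-r) r := ⟨le_rfl, by linarith⟩
  have h0I : (0 : ℝ) ∈ Icc (-r) r := ⟨by linarith, hr.le⟩
  obtain ⟨Cη, hCη⟩ := hbd hη
  obtain ⟨Cρ, hCρ⟩ := hbd hρ
  obtain ⟨m, hm, hmK⟩ := hK.exists_forall_le' (hdcont hf) h.deriv_pos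
  have hstep : ∀ z ∈ ball (extChartAt (𝓡 n) q q) (2 * r), ∀ s ∈ Icc (-r) r, ∀ t ∈ Icc (-r) r,
      s ≤ t → m * (t - s) ≤
        inCoordinates n f q (z + t • V) - inCoordinates n f q (z + s • V) := by
    intro z hz s hs t ht hst
    refine (convex_Icc (-r) r).mul_sub_le_image_sub_of_le_deriv
      (f := fun t : ℝ => inCoordinates n f q (z + t • V)) ?_ ?_ ?_ s hs t ht hst
    · exact fun t ht =>
        (hasDerivAt_line (hdiff hf _ (hmem t ht z hz))).continuousAt.continuousWithinAt
    · exact fun t ht => (hasDerivAt_line (hdiff hf _ (hmem t (interior_subset ht) z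
        hz))).differentiableAt.differentiableWithinAt
    · intro t ht
      rw [(hasDerivAt_line (hdiff hf _ (hmem t (interior_subset ht) z hz))).deriv]
      exact hmK _ (hmem t (interior_subset ht) z hz)
  set C := max 1 (max Cη Cρ) with hC
  have hC1 : 0 < C := zero_lt_one.trans_le (le_max_left _ _)
  have hηC : Cη ≤ C := (le_max_left _ _).trans (le_max_right _ _)
  have hρC : Cρ ≤ C := (le_max_right _ _).trans (le_max_right _ _)
  -- The first bound keeps the derivatives along `V` positive: at most two error terms of size `|ε|
  -- C < m / 4` are subtracted from `m`. The second compares endpoints: `f` changes by at least `m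
  -- r` over time `r`, against at most three error terms below `m r / 4`.
  refine ⟨min (m / (4 * C)) (m * r / (4 * C)), by positivity, fun ε hε => ?_⟩
  have hε1 : |ε| * C < m / 4 := by
    have := (lt_div_iff₀ (by positivity)).1 (hε.trans_le (min_le_left _ _))
    linarith
  have hε2 : |ε| * C < m * r / 4 := by
    have := (lt_div_iff₀ (by positivity)).1 (hε.trans_le (min_le_right _ _))
    linarith
  have hmul : ∀ {a : ℝ}, |a| ≤ C → |ε * a| ≤ |ε| * C := fun ha => by
    rw [abs_mul]; exact mul_le_mul_of_nonneg_left ha (abs_nonneg _)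
  have bη : ∀ z ∈ K, |ε * inCoordinates n η q z| ≤ |ε| * C :=
    fun z hz => hmul ((hCη z hz).1.trans hηC)
  have bρ : ∀ z ∈ K, |ε * inCoordinates n ρ q z| ≤ |ε| * C :=
    fun z hz => hmul ((hCρ z hz).1.trans hρC)
  have bη' : ∀ z ∈ K, |ε * fderiv ℝ (inCoordinates n η q) z V| ≤ |ε| * C :=
    fun z hz => hmul ((hCη z hz).2.trans hηC)
  have bρ' : ∀ z ∈ K, |ε * fderiv ℝ (inCoordinates n ρ q) z V| ≤ |ε| * C :=
    fun z hz => hmul ((hCρ z hz).2.trans hρC)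
  refine exists_diffeomorph_of_isLineChart (V := V) (r := r) (q := q)
    (g := fun x => f x - ε * η x) (g' := fun x => f x - ε * (η x + ρ x)) hk
    (hf.sub (contMDiff_const.mul hη)) (hf.sub (contMDiff_const.mul (hη.add hρ)))
    ⟨hr, h.norm_le, h.subset_target, fun z hz => ?_⟩
    ⟨hr, h.norm_le, h.subset_target, fun z hz => ?_⟩
    (fun x hx => by simp [hsupp x hx]) (fun z hz => ?_) (fun z hz => ?_) (fun z hz => ?_)
    (fun z hz => ?_)
  · have h1 : HasFDerivAt (inCoordinates n (fun x => f x - ε * η x) q) _ z :=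
      (hdiff hf z hz).hasFDerivAt.sub ((hdiff hη z hz).hasFDerivAt.const_mul ε)
    rw [h1.fderiv]
    have := hmK z hz
    have := abs_le.1 (bη' z hz)
    simp only [sub_apply, smul_apply, smul_eq_mul]
    linarith
  · have h1 : HasFDerivAt (inCoordinates n (fun x => f x - ε * (η x + ρ x)) q) _ z :=
      (hdiff hf z hz).hasFDerivAt.sub
        (((hdiff hη z hz).hasFDerivAt.add (hdiff hρ z hz).hasFDerivAt).const_mul ε)
    rw [h1.fderiv]
    have := hmK z hz
    have := abs_le.1 (bη' z hz)
    have := abs_le.1 (bρ' z hz)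
    simp only [sub_apply, smul_apply,
      add_apply, smul_eq_mul]
    linarith
  all_goals
    have z0 := hmem 0 h0I z hz
    have zp := hmem r hrI z hz
    have zm := hmem (-r) hrI' z hz
    have hp := hstep z hz 0 h0I r hrI hr.le
    have hn := hstep z hz (-r) hrI' 0 h0I (by linarith)
    rw [zero_smul, add_zero] at z0 hp hn
    have := abs_le.1 (bη _ z0)
    have := abs_le.1 (bη _ zp)
    have := abs_le.1 (bη _ zm)
    have := abs_le.1 (bρ _ z0)
    have := abs_le.1 (bρ _ zp)
    have := abs_le.1 (bρ _ zm)
    simp only [inCoordinates, Function.comp_apply] at *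
    linarith

/-- Raising the levels of `f` near a closed set of noncritical points by a global diffeomorphism. -/
theorem exists_sweep [T2Space M] [CompactSpace M] [IsManifold (𝓡 n) ∞ M] {k : ℕ∞} (hk : 1 ≤ k)
    {f : M → ℝ} (hf : ContMDiff (𝓡 n) 𝓘(ℝ, ℝ) k f) {s W : Set M} (hs : IsClosed s)
    (hW : IsOpen W) (hsW : s ⊆ W) (hcrit : ∀ x ∈ s, ¬ IsCriticalPoint n f x) :
    ∃ χ : M → ℝ, (∀ x ∈ s, χ x = 1) ∧ (∀ x ∉ W, χ x = 0) ∧ (∀ x, χ x ∈ Icc (0 : ℝ) 1) ∧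
      ∃ ε₀ > 0, ∀ ε : ℝ, |ε| < ε₀ → ∃ Φ : M ≃ₘ^k⟮𝓡 n, 𝓡 n⟯ M,
        ∀ x, f (Φ x) - ε * χ (Φ x) = f x := by
  have hf1 : ContMDiff (𝓡 n) 𝓘(ℝ, ℝ) 1 f :=
    hf.of_le (by exact_mod_cast hk)
  have hex : ∀ q : M, q ∈ s → ∃ (r : ℝ) (V : EuclideanSpace ℝ (Fin n)), IsLineChart f q r V :=
    fun q hq => exists_isLineChart hf1 (hcrit q hq)
  choose! r V hrV using hex
  obtain ⟨t, hts, htcov⟩ := hs.isCompact.elim_nhds_subcover (fun q => chartBall n q (r q))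
    fun q hq => (isOpen_chartBall q _).mem_nhds (mem_chartBall_self q (hrV q hq).pos)
  obtain ⟨p, hp⟩ := SmoothPartitionOfUnity.exists_isSubordinate (𝓡 n) hs
    (fun q : t => chartBall n (q : M) (r q) ∩ W)
    (fun q => (isOpen_chartBall (q : M) _).inter hW) (fun x hx => by
      obtain ⟨q, hq, hxq⟩ := mem_iUnion₂.1 (htcov hx)
      exact mem_iUnion.2 ⟨⟨q, hq⟩, hxq, hsW hx⟩)
  have hpk : ∀ i, ContMDiff (𝓡 n) 𝓘(ℝ, ℝ) k (p i) := fun i =>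
    (p i).contMDiff.of_le (by exact_mod_cast le_top)
  have hp0 : ∀ (i : t) (x : M), x ∉ chartBall n (i : M) (r i) ∩ W → p i x = 0 := fun i x hx =>
    image_eq_zero_of_notMem_tsupport fun h' => hx (hp i h')
  classical
  -- The bumps are switched on one at a time and the diffeomorphisms composed; finiteness keeps `ε₀`
  -- positive.
  have main : ∀ T : Finset t, ∃ ε₀ > 0, ∀ ε : ℝ, |ε| < ε₀ → ∃ Φ : M ≃ₘ^k⟮𝓡 n, 𝓡 n⟯ M,
      ∀ x, f (Φ x) - ε * (∑ i ∈ T, p i (Φ x)) = f x := by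
    intro T
    induction T using Finset.induction_on with
    | empty => exact ⟨1, one_pos, fun ε _ => ⟨Diffeomorph.refl _ _ _, fun x => by simp⟩⟩
    | insert i T hi ih =>
      obtain ⟨ε₁, hε₁, h₁⟩ := ih
      obtain ⟨ε₂, hε₂, h₂⟩ := exists_diffeomorph_step hk hf
        (η := fun x => ∑ j ∈ T, p j x) (ρ := p i)
        (contMDiff_finsetSum fun j _ => hpk j) (hpk i)
        (hrV i (hts i i.2)) fun x hx => hp0 i x fun h' => hx h'.1
      refine ⟨min ε₁ ε₂, lt_min hε₁ hε₂, fun ε hε => ?_⟩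
      obtain ⟨Φ₁, hΦ₁⟩ := h₁ ε (hε.trans_le (min_le_left _ _))
      obtain ⟨Φ₂, hΦ₂⟩ := h₂ ε (hε.trans_le (min_le_right _ _))
      refine ⟨Φ₁.trans Φ₂, fun x => ?_⟩
      have := hΦ₂ (Φ₁ x)
      rw [hΦ₁ x] at this
      rw [← this, Finset.sum_insert hi, add_comm (p i _)]
      rfl
  refine ⟨fun x => ∑ i, p i x, fun x hx => ?_, fun x hx => ?_, fun x => ⟨?_, ?_⟩, main Finset.univ⟩
  · rw [← p.sum_eq_one hx, finsum_eq_sum_of_fintype]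
  · exact Finset.sum_eq_zero fun i _ => hp0 i x fun h' => hx h'.2
  · exact Finset.sum_nonneg fun i _ => p.nonneg i x
  · have := p.sum_le_one x
    rwa [finsum_eq_sum_of_fintype] at this

end MorseLevel

/-! ### Diffeomorphic subsets and invariance of regular levels -/

namespace MorseLevel
open Set Filter Metric

variable {n : ℕ} {M : Type*} [TopologicalSpace M]
  [ChartedSpace (EuclideanSpace ℝ (Fin n)) M]

theorem SubsetsDiffeomorphic.symm {m n : ℕ} {M N : Type*}
    [TopologicalSpace M] [ChartedSpace (EuclideanSpace ℝ (Fin m)) M]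
    [TopologicalSpace N] [ChartedSpace (EuclideanSpace ℝ (Fin n)) N]
    {k : ℕ∞} {A : Set M} {B : Set N} (h : SubsetsDiffeomorphic m n k A B) :
    SubsetsDiffeomorphic n m k B A := by
  obtain ⟨e, h1, h2⟩ := h
  exact ⟨e.symm, h2, h1⟩

theorem IsCkOnSubset.comp {l m n : ℕ} {L M N : Type*}
    [TopologicalSpace L] [ChartedSpace (EuclideanSpace ℝ (Fin l)) L]
    [TopologicalSpace M] [ChartedSpace (EuclideanSpace ℝ (Fin m)) M]
    [TopologicalSpace N] [ChartedSpace (EuclideanSpace ℝ (Fin n)) N]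
    {k : ℕ∞} {A : Set L} {B : Set M} {g : A → B} {h : B → N}
    (hg : IsCkOnSubset l m k A fun x => (g x : M)) (hh : IsCkOnSubset m n k B h) :
    IsCkOnSubset l n k A (h ∘ g) := by
  intro x
  obtain ⟨U, hU, hxU, G, hG, hGg⟩ := hg x
  obtain ⟨U', hU', hxU', H, hH, hHh⟩ := hh (g x)
  refine ⟨U ∩ G ⁻¹' U', hG.continuousOn.isOpen_inter_preimage hU hU', ⟨hxU, ?_⟩, H ∘ G,
    hH.comp (hG.mono inter_subset_left) fun y hy => hy.2, fun y hy => ?_⟩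
  · rw [mem_preimage, hGg x hxU]
    exact hxU'
  · have h2 : G y ∈ U' := hy.2
    rw [Function.comp_apply, hGg y hy.1] at *
    exact hHh (g y) h2

theorem SubsetsDiffeomorphic.trans {l m n : ℕ} {L M N : Type*}
    [TopologicalSpace L] [ChartedSpace (EuclideanSpace ℝ (Fin l)) L]
    [TopologicalSpace M] [ChartedSpace (EuclideanSpace ℝ (Fin m)) M]
    [TopologicalSpace N] [ChartedSpace (EuclideanSpace ℝ (Fin n)) N]
    {k : ℕ∞} {A : Set L} {B : Set M} {C : Set N} (h : SubsetsDiffeomorphic l m k A B)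
    (h' : SubsetsDiffeomorphic m n k B C) : SubsetsDiffeomorphic l n k A C := by
  obtain ⟨e, h1, h2⟩ := h
  obtain ⟨e', h1', h2'⟩ := h'
  exact ⟨e.trans e', h1.comp h1', h2'.comp h2⟩

theorem isCkOnSubset_of_contMDiff {m n : ℕ} {M N : Type*}
    [TopologicalSpace M] [ChartedSpace (EuclideanSpace ℝ (Fin m)) M]
    [TopologicalSpace N] [ChartedSpace (EuclideanSpace ℝ (Fin n)) N]
    {k : ℕ∞} {A : Set M} {G : M → N} (hG : ContMDiff (𝓡 m) (𝓡 n) k G) {g : A → N}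
    (h : ∀ x : A, G x = g x) : IsCkOnSubset m n k A g :=
  fun _ => ⟨univ, isOpen_univ, mem_univ _, G, hG.contMDiffOn, fun y _ => h y⟩

/-- A global diffeomorphism restricts to a diffeomorphism between corresponding subsets. -/
theorem subsetsDiffeomorphic_of_diffeomorph {k : ℕ∞} (Φ : M ≃ₘ^k⟮𝓡 n, 𝓡 n⟯ M) {A B : Set M}
    (h : ∀ x, x ∈ A ↔ Φ x ∈ B) : SubsetsDiffeomorphic n n k A B :=
  ⟨Φ.toEquiv.subtypeEquiv h, isCkOnSubset_of_contMDiff Φ.contMDiff fun _ => rfl,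
    isCkOnSubset_of_contMDiff Φ.symm.contMDiff fun _ => rfl⟩

/-- Away from an open set `B` that contains all critical points of level `u`, there are no critical
points of level close to `u`. -/
theorem exists_band [CompactSpace M] [T2Space M] [IsManifold (𝓡 n) ∞ M]
    {f : M → ℝ} (hf : ContMDiff (𝓡 n) 𝓘(ℝ, ℝ) 1 f) {u : ℝ} {B : Set M} (hB : IsOpen B)
    (hcrit : ∀ x, f x = u → IsCriticalPoint n f x → x ∈ B) :
    ∃ η > 0, ∀ x, |f x - u| ≤ η → x ∉ B → ¬ IsCriticalPoint n f x := by
  -- Criticality at `x` near `q` is tested in the chart at `q`: by the chain rule a critical `x`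
  -- would kill the positive derivative along `V`.
  have hop : IsOpen {x : M | ¬ IsCriticalPoint n f x} := by
    rw [isOpen_iff_mem_nhds]
    intro q hq
    obtain ⟨r, V, h⟩ := exists_isLineChart hf hq
    filter_upwards [(isOpen_chartBall (n := n) q r).mem_nhds (mem_chartBall_self q h.pos)]
      with x hx hxc
    have hpos := h.deriv_pos _ (closedBall_subset_closedBall (by linarith [h.pos])
      (ball_subset_closedBall hx.2))
    have h1 : MDifferentiableAt 𝓘(ℝ, EuclideanSpace ℝ (Fin n)) (𝓡 n) (extChartAt (𝓡 n) q).symm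
        (extChartAt (𝓡 n) q x) :=
      ((contMDiffOn_extChartAt_symm (n := 1) q).contMDiffAt
        ((isOpen_extChartAt_target q).mem_nhds
          ((extChartAt (𝓡 n) q).map_source hx.1))).mdifferentiableAt one_ne_zero
    have hx' := (extChartAt (𝓡 n) q).left_inv hx.1
    have h2 := mfderiv_comp (I'' := 𝓘(ℝ, ℝ)) (extChartAt (𝓡 n) q x)
      (g := f) (hf.mdifferentiable one_ne_zero _) h1
    rw [hx'] at h2
    unfold IsCriticalPoint at hxc
    rw [hxc] at h2
    have h3 : fderiv ℝ (inCoordinates n f q) (extChartAt (𝓡 n) q x) = 0 := by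
      rw [← mfderiv_eq_fderiv]
      exact h2.trans (ContinuousLinearMap.zero_comp _)
    rw [h3] at hpos
    simp at hpos
  -- On the compact set of critical points outside `B`, the positive function `|f - u|` is bounded
  -- away from zero.
  have hK : IsCompact (B ∪ {x | ¬ IsCriticalPoint n f x})ᶜ :=
    (hB.union hop).isClosed_compl.isCompact
  obtain ⟨η, hη, h⟩ := hK.exists_forall_le' (f := fun x => |f x - u|) (a := 0)
    (by have := hf.continuous; fun_prop) fun x hx => by
      rw [abs_pos, sub_ne_zero]
      intro hxu
      exact hx (by_contra fun hx' => hx' (Or.inl (hcrit x hxu (by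
        by_contra hc; exact hx (Or.inr hc)))))
  refine ⟨η / 2, by positivity, fun x hx hxB hxc => ?_⟩
  have : η ≤ |f x - u| := h x (by rintro (h' | h'); exacts [hxB h', h' hxc])
  linarith

/-- Sweep with `ε = v - u` over a band around the level `u`. Every point that matters stays in the
band, where `χ = 1`, so the image of the level `u` is exactly the level `v`. -/
theorem exists_diffeomorphic_levelSet [CompactSpace M] [T2Space M] [IsManifold (𝓡 n) ∞ M]
    {k : ℕ∞} (hk : 1 ≤ k) {f : M → ℝ} (hf : ContMDiff (𝓡 n) 𝓘(ℝ, ℝ) k f) {u : ℝ}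
    (hcrit : ∀ x, f x = u → ¬ IsCriticalPoint n f x) :
    ∃ δ > 0, ∀ v, |v - u| < δ → SubsetsDiffeomorphic n n k (levelSet f u) (levelSet f v) := by
  have hf1 : ContMDiff (𝓡 n) 𝓘(ℝ, ℝ) 1 f := hf.of_le (by exact_mod_cast hk)
  obtain ⟨η, hη, hη'⟩ := exists_band hf1 (u := u) isOpen_empty fun x hx hc => hcrit x hx hc
  obtain ⟨χ, hχ, -, hχ01, ε₀, hε₀, hΦ⟩ := exists_sweep hk hf (s := {x | |f x - u| ≤ η})
    (isClosed_le (by have := hf.continuous; fun_prop) continuous_const) isOpen_univ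
    (subset_univ _) fun x hx => hη' x hx (notMem_empty x)
  refine ⟨min η ε₀, lt_min hη hε₀, fun v hv => ?_⟩
  obtain ⟨Φ, h⟩ := hΦ (v - u) (hv.trans_le (min_le_right _ _))
  refine subsetsDiffeomorphic_of_diffeomorph Φ fun x => ?_
  have hx := h x
  have hb : |(v - u) * χ (Φ x)| ≤ |v - u| := by
    rw [abs_mul, abs_of_nonneg (hχ01 _).1]
    exact mul_le_of_le_one_right (abs_nonneg _) (hχ01 _).2
  have hvη := hv.trans_le (min_le_left _ _)
  simp only [levelSet, mem_ofPred_eq]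
  constructor
  · intro hxu
    have h1 : χ (Φ x) = 1 := hχ _ (by
      rw [mem_ofPred_eq, show f (Φ x) - u = (v - u) * χ (Φ x) by linarith]
      linarith)
    rw [h1] at hx
    linarith
  · intro hxv
    have h1 : χ (Φ x) = 1 := hχ _ (by rw [mem_ofPred_eq, hxv]; linarith)
    rw [h1] at hx
    linarith

/-- Level sets of regular values in an interval without critical values are diffeomorphic. -/
theorem levelSet_diffeomorphic [CompactSpace M] [T2Space M] [IsManifold (𝓡 n) ∞ M]
    {k : ℕ∞} (hk : 1 ≤ k) {f : M → ℝ} (hf : ContMDiff (𝓡 n) 𝓘(ℝ, ℝ) k f) {u v : ℝ} (huv : u ≤ v)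
    (hcrit : ∀ p, IsCriticalPoint n f p → f p ∉ Icc u v) :
    SubsetsDiffeomorphic n n k (levelSet f u) (levelSet f v) := by
  -- A symmetric and transitive relation that holds locally holds throughout a connected interval.
  refine isPreconnected_Icc.induction₂
    (fun a b => SubsetsDiffeomorphic n n k (levelSet f a) (levelSet f b)) ?_
    (fun a b c _ _ _ h h' => h.trans h') (fun a b _ _ h => h.symm)
    (left_mem_Icc.2 huv) (right_mem_Icc.2 huv)
  intro w hw
  obtain ⟨δ, hδ, h⟩ := exists_diffeomorphic_levelSet hk hf (u := w)
    fun x hx hc => hcrit x hc (hx ▸ hw)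
  refine mem_nhdsWithin_of_mem_nhds ?_
  filter_upwards [ball_mem_nhds w hδ] with w' hw'
  exact h w' (by rwa [mem_ball, Real.dist_eq] at hw')

end MorseLevel

/-! ### Splitting the Hessian, and saddles -/

namespace MorseLevel
open Set Filter Metric

section Splitting

theorem bilin_apply_eq_dotProduct {n : ℕ}
    (H : EuclideanSpace ℝ (Fin n) →L[ℝ] EuclideanSpace ℝ (Fin n) →L[ℝ] ℝ)
    {A : Matrix (Fin n) (Fin n) ℝ}
    (hA : ∀ i j, A i j = H (EuclideanSpace.single i 1) (EuclideanSpace.single j 1))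
    (x y : EuclideanSpace ℝ (Fin n)) : H x y = x.ofLp ⬝ᵥ (A.mulVec y.ofLp) := by
  have hx := (EuclideanSpace.basisFun (Fin n) ℝ).sum_repr x
  have hy := (EuclideanSpace.basisFun (Fin n) ℝ).sum_repr y
  conv_lhs => rw [← hx, ← hy]
  simp only [map_sum, map_smul, sum_apply, smul_apply, smul_eq_mul,
    EuclideanSpace.basisFun_apply, EuclideanSpace.basisFun_repr, dotProduct, Matrix.mulVec,
    Finset.mul_sum, hA]
  rw [Finset.sum_comm]
  refine Finset.sum_congr rfl fun i _ => Finset.sum_congr rfl fun j _ => by ring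

/-- A nondegenerate symmetric bilinear form on `ℝⁿ` is diagonal, without zeros, in an orthonormal
basis. -/
theorem exists_orthonormalBasis_diagonal {n : ℕ}
    (H : EuclideanSpace ℝ (Fin n) →L[ℝ] EuclideanSpace ℝ (Fin n) →L[ℝ] ℝ)
    (hsymm : ∀ x y, H x y = H y x) {A : Matrix (Fin n) (Fin n) ℝ}
    (hA : ∀ i j, A i j = H (EuclideanSpace.single i 1) (EuclideanSpace.single j 1))
    (hdet : A.det ≠ 0) :
    ∃ (b : OrthonormalBasis (Fin n) ℝ (EuclideanSpace ℝ (Fin n))) (l : Fin n → ℝ),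
      (∀ i j, H (b i) (b j) = if i = j then l i else 0) ∧ (∀ i, l i ≠ 0) ∧
      (matrixIndex A = 0 → ∀ i, 0 < l i) := by
  have hH : A.IsHermitian := by
    ext i j
    simp [Matrix.conjTranspose_apply, hA, hsymm]
  have hl : ∀ i, hH.eigenvalues i ≠ 0 := by
    rw [hH.det_eq_prod_eigenvalues] at hdet
    intro i hi
    exact hdet (Finset.prod_eq_zero (Finset.mem_univ i) (by simp [hi]))
  refine ⟨hH.eigenvectorBasis, hH.eigenvalues, fun i j => ?_, hl, fun h0 i => ?_⟩
  · rw [bilin_apply_eq_dotProduct H hA, hH.mulVec_eigenvectorBasis, dotProduct_smul]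
    have := (orthonormal_iff_ite.1 hH.eigenvectorBasis.orthonormal) j i
    rw [EuclideanSpace.inner_eq_star_dotProduct] at this
    simp only [star_trivial] at this
    rw [this]
    by_cases hij : i = j
    · subst hij; simp
    · simp [hij, Ne.symm hij]
  · refine lt_of_le_of_ne ?_ (hl i).symm
    by_contra! hneg
    rw [matrixIndex, Multiset.card_eq_zero, Multiset.filter_eq_nil] at h0
    refine h0 (hH.eigenvalues i) ?_ hneg
    rw [hH.roots_charpoly_eq_eigenvalues]
    exact Multiset.mem_map_of_mem _ (Finset.mem_univ i)

/-- A nondegenerate symmetric bilinear form is positive definite on one summand and negative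
definite on the other summand of a decomposition of the space. -/
theorem exists_splitting {n : ℕ}
    (H : EuclideanSpace ℝ (Fin n) →L[ℝ] EuclideanSpace ℝ (Fin n) →L[ℝ] ℝ)
    (hsymm : ∀ x y, H x y = H y x) {A : Matrix (Fin n) (Fin n) ℝ}
    (hA : ∀ i j, A i j = H (EuclideanSpace.single i 1) (EuclideanSpace.single j 1))
    (hdet : A.det ≠ 0) :
    ∃ (P Q : Submodule ℝ (EuclideanSpace ℝ (Fin n)))
      (π : EuclideanSpace ℝ (Fin n) →L[ℝ] EuclideanSpace ℝ (Fin n)) (c : ℝ), 0 < c ∧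
      (∀ x, π x ∈ P) ∧ (∀ x, x - π x ∈ Q) ∧ (∀ x ∈ P, c * ‖x‖ ^ 2 ≤ H x x) ∧
      (∀ x ∈ Q, H x x ≤ -c * ‖x‖ ^ 2) ∧ (matrixIndex A = 0 → P = ⊤) := by
  obtain ⟨b, l, hb, hl, hidx⟩ := exists_orthonormalBasis_diagonal H hsymm hA hdet
  have hHx : ∀ x, H x x = ∑ i, l i * (inner ℝ (b i) x) ^ 2 := by
    intro x
    conv_lhs => rw [← b.sum_repr' x]
    simp [sum_apply, hb, pow_two]
    exact Finset.sum_congr rfl fun i _ => by ring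
  have hnorm : ∀ x, ‖x‖ ^ 2 = ∑ i, (inner ℝ (b i) x) ^ 2 := by
    intro x
    rw [← b.sum_sq_norm_inner_right x]
    simp
  obtain ⟨c, hc, hcl⟩ : ∃ c > 0, ∀ i, c ≤ |l i| := by
    obtain ⟨c, hc, h⟩ := isCompact_univ.exists_forall_le' (f := fun i => |l i|) (a := 0)
      continuous_of_discreteTopology.continuousOn fun i _ => abs_pos.2 (hl i)
    exact ⟨c, hc, fun i => h i (mem_univ i)⟩
  -- Vectors whose coordinates in the eigenbasis vanish at the indices satisfying `p`. Since no
  -- eigenvalue is zero, killing the negative coordinates leaves the positive directions, and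
  -- conversely.
  let sub (p : Fin n → Prop) : Submodule ℝ (EuclideanSpace ℝ (Fin n)) :=
    ⨅ (i : Fin n) (_ : p i), LinearMap.ker (innerSL ℝ (b i)).toLinearMap
  have hsub : ∀ p x, x ∈ sub p ↔ ∀ i, p i → inner ℝ (b i) x = 0 := fun p x => by
    simp [sub, Submodule.mem_iInf]
  classical
  let π : EuclideanSpace ℝ (Fin n) →L[ℝ] EuclideanSpace ℝ (Fin n) :=
    ∑ i, if 0 < l i then (innerSL ℝ (b i)).smulRight (b i) else 0
  have hπ : ∀ i x, inner ℝ (b i) (π x) = if 0 < l i then inner ℝ (b i) x else 0 := by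
    intro i x
    have : π x = ∑ j, (if 0 < l j then inner ℝ (b j) x else 0) • b j := by
      simp only [π, sum_apply]
      refine Finset.sum_congr rfl fun j _ => ?_
      split_ifs <;> simp
    rw [this]
    simp only [inner_sum, inner_smul_right, orthonormal_iff_ite.1 b.orthonormal]
    simp
  refine ⟨sub fun i => l i < 0, sub fun i => 0 < l i, π, c, hc, ?_, ?_, ?_, ?_, ?_⟩
  · intro x
    rw [hsub]
    intro i hi
    rw [hπ, if_neg hi.not_gt]
  · intro x
    rw [hsub]
    intro i hi
    rw [inner_sub_right, hπ, if_pos hi, sub_self]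
  · intro x hx
    rw [hsub] at hx
    rw [hHx, hnorm, Finset.mul_sum]
    refine Finset.sum_le_sum fun i _ => ?_
    rcases (hl i).lt_or_gt with hi | hi
    · simp [hx i hi]
    · have := hcl i
      rw [abs_of_pos hi] at this
      exact mul_le_mul_of_nonneg_right this (sq_nonneg _)
  · intro x hx
    rw [hsub] at hx
    rw [hHx, hnorm, Finset.mul_sum]
    refine Finset.sum_le_sum fun i _ => ?_
    rcases (hl i).lt_or_gt with hi | hi
    · have := hcl i
      rw [abs_of_neg hi] at this
      exact mul_le_mul_of_nonneg_right (by linarith) (sq_nonneg _)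
    · simp [hx i hi]
  · intro h0
    rw [eq_top_iff]
    intro x _
    rw [hsub]
    exact fun i hi => absurd (hidx h0 i) hi.not_gt

end Splitting

section Saddle

variable {E : Type*} [NormedAddCommGroup E] [NormedSpace ℝ E]

/-- On the ball of radius `ρ` about its critical point `a`, the function `F` is uniformly convex
in the directions of `P` and uniformly concave in the directions of `Q`. -/
structure IsSaddle (F : E → ℝ) (a : E) (ρ c : ℝ) (P Q : Submodule ℝ E) : Prop where
  pos : 0 < ρ
  const_pos : 0 < c
  differentiableAt : ∀ x ∈ ball a ρ, DifferentiableAt ℝ F x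
  fderiv_eq_zero : fderiv ℝ F a = 0
  mono : ∀ x ∈ ball a ρ, ∀ v ∈ P, x + v ∈ ball a ρ →
    c * ‖v‖ ^ 2 ≤ (fderiv ℝ F (x + v) - fderiv ℝ F x) v
  anti : ∀ x ∈ ball a ρ, ∀ v ∈ Q, x + v ∈ ball a ρ →
    (fderiv ℝ F (x + v) - fderiv ℝ F x) v ≤ -c * ‖v‖ ^ 2

variable {F : E → ℝ} {a : E} {ρ c : ℝ} {P Q : Submodule ℝ E}

theorem IsSaddle.neg (h : IsSaddle F a ρ c P Q) : IsSaddle (fun x => -F x) a ρ c Q P where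
  pos := h.pos
  const_pos := h.const_pos
  differentiableAt x hx := (h.differentiableAt x hx).neg
  fderiv_eq_zero := by rw [fderiv_fun_neg, h.fderiv_eq_zero, neg_zero]
  mono x hx v hv hxv := by
    have := h.anti x hx v hv hxv
    rw [fderiv_fun_neg, fderiv_fun_neg]
    simp only [sub_apply, neg_apply] at this ⊢
    linarith
  anti x hx v hv hxv := by
    have := h.mono x hx v hv hxv
    rw [fderiv_fun_neg, fderiv_fun_neg]
    simp only [sub_apply, neg_apply] at this ⊢
    linarith

theorem IsSaddle.mono_radius (h : IsSaddle F a ρ c P Q) {ρ' : ℝ} (hρ' : 0 < ρ') (hle : ρ' ≤ ρ) :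
    IsSaddle F a ρ' c P Q where
  pos := hρ'
  const_pos := h.const_pos
  differentiableAt x hx := h.differentiableAt x (ball_subset_ball hle hx)
  fderiv_eq_zero := h.fderiv_eq_zero
  mono x hx v hv hxv := h.mono x (ball_subset_ball hle hx) v hv (ball_subset_ball hle hxv)
  anti x hx v hv hxv := h.anti x (ball_subset_ball hle hx) v hv (ball_subset_ball hle hxv)

/-- A `C²` function is a saddle near a nondegenerate critical point. -/
theorem exists_isSaddle {H : E →L[ℝ] E →L[ℝ] ℝ} (hF : ContDiffAt ℝ 2 F a)
    (hH : fderiv ℝ (fderiv ℝ F) a = H) (hcrit : fderiv ℝ F a = 0) (hc : 0 < c)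
    (hP : ∀ x ∈ P, c * ‖x‖ ^ 2 ≤ H x x) (hQ : ∀ x ∈ Q, H x x ≤ -c * ‖x‖ ^ 2) :
    ∃ ρ > 0, IsSaddle F a ρ (c / 2) P Q := by
  -- Strict differentiability compares the differential at two arbitrary points near `a` using `H`
  -- alone; its error costs half of `c`.
  have hG : HasStrictFDerivAt (fderiv ℝ F) H a := by
    rw [← hH]
    exact (hF.fderiv_right (m := 1) (by norm_num)).hasStrictFDerivAt one_ne_zero
  have h1 : ∀ᶠ p : E × E in 𝓝 (a, a),
      ‖fderiv ℝ F p.1 - fderiv ℝ F p.2 - H (p.1 - p.2)‖ ≤ c / 2 * ‖p.1 - p.2‖ :=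
    hG.isLittleO.def (by positivity)
  have h2 : ∀ᶠ x in 𝓝 a, DifferentiableAt ℝ F x :=
    (hF.eventually (by simp)).mono fun x hx => hx.differentiableAt two_ne_zero
  rw [nhds_prod_eq, Filter.eventually_iff] at h1
  obtain ⟨t, ht, h1⟩ := mem_prod_same_iff.1 h1
  have h1' : ∀ x ∈ t, ∀ y ∈ t,
      ‖fderiv ℝ F x - fderiv ℝ F y - H (x - y)‖ ≤ c / 2 * ‖x - y‖ := by
    intro x hx y hy
    have hxy : (x, y) ∈ t ×ˢ t := mk_mem_prod hx hy
    have := h1 hxy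
    rwa [mem_ofPred_eq] at this
  obtain ⟨ρ, hρ, hsub⟩ := Metric.mem_nhds_iff.1 (inter_mem ht h2)
  have key : ∀ x ∈ ball a ρ, ∀ v, x + v ∈ ball a ρ →
      |(fderiv ℝ F (x + v) - fderiv ℝ F x) v - H v v| ≤ c / 2 * ‖v‖ ^ 2 := by
    intro x hx v hxv
    have := h1' (x + v) (hsub hxv).1 x (hsub hx).1
    rw [add_sub_cancel_left] at this
    have h3 := (fderiv ℝ F (x + v) - fderiv ℝ F x - H v).le_of_opNorm_le this v
    rw [Real.norm_eq_abs, sub_apply] at h3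
    calc _ ≤ _ := h3
      _ = _ := by ring
  refine ⟨ρ, hρ, hρ, by positivity, fun x hx => (hsub hx).2, hcrit, ?_, ?_⟩
  · intro x hx v hv hxv
    have := abs_le.1 (key x hx v hxv)
    have := hP v hv
    linarith
  · intro x hx v hv hxv
    have := abs_le.1 (key x hx v hxv)
    have := hQ v hv
    linarith

theorem add_smul_mem_ball_of_mem {x v : E} {T t : ℝ} (hx : x ∈ ball a ρ)
    (hv : x + T • v ∈ ball a ρ) (ht : t ∈ Icc 0 T) : x + t • v ∈ ball a ρ := by
  rcases ht.1.eq_or_lt with h0 | h0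
  · simpa [← h0] using hx
  have hT : 0 < T := h0.trans_le ht.2
  have := (convex_ball a ρ).add_smul_mem hx hv (t := t / T)
    ⟨by have := ht.1; positivity, (div_le_one hT).2 ht.2⟩
  rwa [smul_smul, div_mul_cancel₀ _ hT.ne'] at this

/-- The `mono` inequality makes the derivative along the line monotone. -/
theorem IsSaddle.convexOn_line (h : IsSaddle F a ρ c P Q) {x v : E} {T : ℝ} (hv : v ∈ P)
    (hx : ∀ t ∈ Icc 0 T, x + t • v ∈ ball a ρ) :
    ConvexOn ℝ (Icc 0 T) fun t : ℝ => F (x + t • v) := by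
  have hd : ∀ t ∈ Icc 0 T, HasDerivAt (fun t : ℝ => F (x + t • v)) _ t := fun t ht =>
    hasDerivAt_line (h.differentiableAt _ (hx t ht))
  refine MonotoneOn.convexOn_of_deriv (convex_Icc _ _)
    (fun t ht => (hd t ht).continuousAt.continuousWithinAt)
    (fun t ht => (hd t (interior_subset ht)).differentiableAt.differentiableWithinAt) ?_
  intro s hs t ht hst
  rw [(hd s (interior_subset hs)).deriv, (hd t (interior_subset ht)).deriv]
  rcases hst.eq_or_lt with rfl | hst
  · rfl
  have hadd : x + s • v + (t - s) • v = x + t • v := by rw [add_assoc, ← add_smul]; congr 2; ring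
  have := h.mono _ (hx s (interior_subset hs)) ((t - s) • v) (P.smul_mem _ hv)
    (by rw [hadd]; exact hx t (interior_subset ht))
  rw [hadd, map_smul, smul_eq_mul, sub_apply] at this
  have h0 : 0 ≤ c * ‖(t - s) • v‖ ^ 2 := by have := h.const_pos; positivity
  have := nonneg_of_mul_nonneg_right (h0.trans this) (sub_pos.2 hst)
  linarith

theorem IsSaddle.le_fderiv (h : IsSaddle F a ρ c P Q) {v : E} (hv : v ∈ P)
    (hav : a + v ∈ ball a ρ) : c * ‖v‖ ^ 2 ≤ fderiv ℝ F (a + v) v := by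
  simpa [h.fderiv_eq_zero] using h.mono a (mem_ball_self h.pos) v hv hav

theorem IsSaddle.le_apply (h : IsSaddle F a ρ c P Q) {v : E} (hv : v ∈ P)
    (hav : a + v ∈ ball a ρ) : F a + c / 2 * ‖v‖ ^ 2 ≤ F (a + v) := by
  have hx : ∀ t ∈ Icc (0 : ℝ) 1, a + t • v ∈ ball a ρ := fun t ht =>
    add_smul_mem_ball_of_mem (mem_ball_self h.pos) (by rwa [one_smul]) ht
  -- Subtracting the quadratic leaves a nondecreasing function, because the derivative of `F` at `a
  -- + t • v` along `v` is at least `c * ‖v‖ ^ 2 * t`.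
  have hd : ∀ t ∈ Icc (0 : ℝ) 1,
      HasDerivAt (fun t : ℝ => F (a + t • v) - c / 2 * ‖v‖ ^ 2 * t ^ 2)
        (fderiv ℝ F (a + t • v) v - c / 2 * ‖v‖ ^ 2 * (2 * t)) t := fun t ht => by
    refine (hasDerivAt_line (h.differentiableAt _ (hx t ht))).sub
      (HasDerivAt.const_mul _ ?_)
    simpa using hasDerivAt_pow 2 t
  have hmono : MonotoneOn (fun t : ℝ => F (a + t • v) - c / 2 * ‖v‖ ^ 2 * t ^ 2) (Icc 0 1) := by
    refine monotoneOn_of_deriv_nonneg (convex_Icc _ _)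
      (fun t ht => (hd t ht).continuousAt.continuousWithinAt)
      (fun t ht => (hd t (interior_subset ht)).differentiableAt.differentiableWithinAt) ?_
    intro t ht
    rw [(hd t (interior_subset ht)).deriv]
    rw [interior_Icc] at ht
    have := h.le_fderiv (P.smul_mem t hv) (hx t (Ioo_subset_Icc_self ht))
    rw [map_smul, smul_eq_mul, norm_smul, Real.norm_eq_abs, abs_of_pos ht.1] at this
    have h3 : t * (c * ‖v‖ ^ 2 * t) ≤ t * fderiv ℝ F (a + t • v) v := by
      calc _ = _ := by ring
        _ ≤ _ := this
    have := le_of_mul_le_mul_left h3 ht.1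
    linarith
  have := hmono (left_mem_Icc.2 zero_le_one) (right_mem_Icc.2 zero_le_one) zero_le_one
  simp only [zero_smul, add_zero, one_smul] at this
  linarith

end Saddle

end MorseLevel

/-! ### Levels near a saddle -/

namespace MorseLevel
open Set Filter Metric

/-- A convex function on `[0, T]` that starts below the level `w` and ends above it crosses this
level exactly once. -/
theorem exists_crossing_of_convexOn {φ : ℝ → ℝ} {T w : ℝ} (hT : 0 ≤ T)
    (hφ : ConvexOn ℝ (Icc 0 T) φ) (hc : ContinuousOn φ (Icc 0 T)) (h0 : φ 0 < w) (h1 : w < φ T) :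
    ∃ t ∈ Ioo 0 T, φ t = w ∧ (∀ s ∈ Icc 0 T, s < t → φ s < w) ∧ ∀ s ∈ Icc 0 T, t < s → w < φ s := by
  obtain ⟨t, ht, rfl⟩ := intermediate_value_Ioo hT hc ⟨h0, h1⟩
  refine ⟨t, ht, rfl, fun s hs hst => ?_, fun s hs hst => ?_⟩
  · have h := hφ.2 (left_mem_Icc.2 hT) (Ioo_subset_Icc_self ht)
      (show (0 : ℝ) ≤ 1 - s / t from sub_nonneg.2 ((div_le_one ht.1).2 hst.le))
      (show 0 ≤ s / t from div_nonneg hs.1 ht.1.le) (by ring)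
    simp only [smul_eq_mul, mul_zero, zero_add, div_mul_cancel₀ _ ht.1.ne'] at h
    have h' : s / t < 1 := (div_lt_one ht.1).2 hst
    nlinarith
  · have hs0 : 0 < s := ht.1.trans hst
    have h := hφ.2 (left_mem_Icc.2 hT) hs
      (show (0 : ℝ) ≤ 1 - t / s from sub_nonneg.2 ((div_le_one hs0).2 hst.le))
      (show 0 ≤ t / s from div_nonneg ht.1.le hs0.le) (by ring)
    simp only [smul_eq_mul, mul_zero, zero_add, div_mul_cancel₀ _ hs0.ne'] at h
    have h' : t / s < 1 := (div_lt_one hs0).2 hst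
    have h'' : 0 < t / s := div_pos ht.1 hs0
    nlinarith

theorem continuous_crossing {X : Type*} [TopologicalSpace X] {F : X → ℝ → ℝ} {τ : X → ℝ} {T w : ℝ}
    (hτ : ∀ x, τ x ∈ Ioo 0 T) (hτw : ∀ x, F x (τ x) = w)
    (hlt : ∀ x, ∀ s ∈ Icc 0 T, s < τ x → F x s < w) (hgt : ∀ x, ∀ s ∈ Icc 0 T, τ x < s → w < F x s)
    (hc : ∀ x, ∀ t ∈ Ioo 0 T, ContinuousAt (fun y => F y t) x) : Continuous τ := by
  rw [continuous_iff_continuousAt]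
  intro x₀
  refine continuousAt_crossing (F := fun x t => F x t - w) (hτ x₀)
    (fun t ht => (hc x₀ t ht).sub continuousAt_const)
    (fun t ht h => sub_neg.2 (hlt x₀ t (Ioo_subset_Icc_self ht) h))
    (fun t ht h => sub_pos.2 (hgt x₀ t (Ioo_subset_Icc_self ht) h))
    (Eventually.of_forall fun x t ht => ⟨fun h => ?_, fun h => ?_⟩)
  · by_contra! hle
    rcases hle.eq_or_lt with rfl | hlt'
    · linarith [hτw x]
    · linarith [hgt x t (Ioo_subset_Icc_self ht) hlt']
  · by_contra! hle
    rcases hle.eq_or_lt with rfl | hlt'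
    · linarith [hτw x]
    · linarith [hlt x t (Ioo_subset_Icc_self ht) hlt']

section Sphere

variable {E : Type*} [NormedAddCommGroup E] [NormedSpace ℝ E]

/-- The unit sphere of a subspace is the union of two preconnected sets. -/
theorem exists_isPreconnected_cover_sphere (P : Submodule ℝ E) :
    ∃ T₁ T₂ : Set E, IsPreconnected T₁ ∧ IsPreconnected T₂ ∧
      T₁ ∪ T₂ = {θ | θ ∈ P ∧ ‖θ‖ = 1} := by
  by_cases h : 1 < Module.rank ℝ P
  · refine ⟨(fun x : P => (x : E)) '' sphere 0 1, ∅,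
      (isPreconnected_sphere h 0 1).image _ continuous_subtype_val.continuousOn,
      isPreconnected_empty, ?_⟩
    ext θ
    simp only [union_empty, mem_image, mem_sphere_zero_iff_norm]
    constructor
    · rintro ⟨x, hx, rfl⟩
      exact ⟨x.2, hx⟩
    · rintro ⟨h1, h2⟩
      exact ⟨⟨θ, h1⟩, h2, rfl⟩
  -- In dimension at most one the sphere is empty or a pair of antipodal points.
  · obtain ⟨v₀, hv₀⟩ := rank_le_one_iff.1 (not_lt.1 h)
    by_cases hne : ∃ θ, θ ∈ P ∧ ‖θ‖ = 1
    · obtain ⟨θ₀, hθ₀, hn⟩ := hne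
      refine ⟨{θ₀}, {-θ₀}, isPreconnected_singleton, isPreconnected_singleton, ?_⟩
      ext θ
      simp only [mem_union, mem_singleton_iff]
      constructor
      · rintro (rfl | rfl)
        · exact ⟨hθ₀, hn⟩
        · exact ⟨P.neg_mem hθ₀, by rwa [norm_neg]⟩
      · rintro ⟨h1, h2⟩
        obtain ⟨c₀, hc₀⟩ := hv₀ ⟨θ₀, hθ₀⟩
        obtain ⟨c, hc⟩ := hv₀ ⟨θ, h1⟩
        have e₀ : c₀ • (v₀ : E) = θ₀ := congrArg Subtype.val hc₀
        have e : c • (v₀ : E) = θ := congrArg Subtype.val hc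
        rw [← e₀, norm_smul] at hn
        rw [← e, norm_smul] at h2
        have hv : ‖(v₀ : E)‖ ≠ 0 := fun h0 => by simp [h0] at hn
        have hcc : ‖c‖ = ‖c₀‖ := mul_right_cancel₀ hv (h2.trans hn.symm)
        rw [← e, ← e₀, ← neg_smul]
        rcases abs_eq_abs.1 hcc with h | h
        · left; rw [h]
        · right; rw [h]
    · exact ⟨∅, ∅, isPreconnected_empty, isPreconnected_empty, by
        ext θ; simpa using fun h1 h2 => hne ⟨θ, h1, h2⟩⟩

end Sphere

section Saddle

variable {E : Type*} [NormedAddCommGroup E] [NormedSpace ℝ E] {F : E → ℝ} {a : E} {ρ c : ℝ}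
  {P Q : Submodule ℝ E}

/-- Near a saddle, the level sets slightly above the critical level are covered by two connected
pieces. -/
theorem IsSaddle.exists_isPreconnected_cover [ProperSpace E] (h : IsSaddle F a ρ c P Q)
    (π : E →L[ℝ] E) (hπP : ∀ x, π x ∈ P) (hπQ : ∀ x, x - π x ∈ Q) :
    ∃ r > 0, ∃ ε₀ > 0, ∀ w ∈ Ioo (F a) (F a + ε₀), ∃ C₁ C₂ : Set E,
      IsPreconnected C₁ ∧ IsPreconnected C₂ ∧ C₁ ∪ C₂ ⊆ ball a ρ ∩ F ⁻¹' {w} ∧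
      ball a r ∩ F ⁻¹' {w} ⊆ C₁ ∪ C₂ := by
  have hρ := h.pos
  set R := ρ / 2 with hR
  have hR0 : 0 < R := by positivity
  set m := c / 2 * R ^ 2 with hm
  have hm0 : 0 < m := by have := h.const_pos; positivity
  have hFc : ∀ x ∈ ball a ρ, ContinuousAt F x := fun x hx => (h.differentiableAt x hx).continuousAt
  have huc : UniformContinuousOn F (closedBall a (3 / 4 * ρ)) :=
    (isCompact_closedBall _ _).uniformContinuousOn_of_continuous fun x hx =>
      (hFc x (closedBall_subset_ball (by linarith) hx)).continuousWithinAt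
  obtain ⟨δ₀, hδ₀, hδ⟩ := Metric.uniformContinuousOn_iff.1 huc (m / 2) (by positivity)
  set δ := min δ₀ (ρ / 4) with hδdef
  have hδ0 : 0 < δ := by positivity
  have hδ1 : δ ≤ δ₀ := min_le_left _ _
  have hδ2 : δ ≤ ρ / 4 := min_le_right _ _
  -- Parameters of the graph: a base point in `Q` and a unit direction in `P`. Along each ray `F` is
  -- convex, starts at most at `F a` and ends above `F a + m / 2`, so it crosses the level once. The
  -- bound `δ ≤ ρ / 4` keeps rays of length `ρ / 2` in the ball.
  set D : Set (E × E) := {p | (p.1 ∈ Q ∧ ‖p.1‖ < δ) ∧ p.2 ∈ P ∧ ‖p.2‖ = 1} with hD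
  have hmem : ∀ p ∈ D, ∀ t ∈ Icc 0 R, ‖p.1 + t • p.2‖ < 3 / 4 * ρ := by
    intro p hp t ht
    calc ‖p.1 + t • p.2‖ ≤ ‖p.1‖ + ‖t • p.2‖ := norm_add_le _ _
      _ = ‖p.1‖ + t := by rw [norm_smul, hp.2.2, mul_one, Real.norm_of_nonneg ht.1]
      _ < 3 / 4 * ρ := by have := hp.1.2; have := ht.2; linarith
  have hball : ∀ p ∈ D, ∀ t ∈ Icc 0 R, a + p.1 + t • p.2 ∈ ball a ρ := by
    intro p hp t ht
    rw [mem_ball, dist_eq_norm, add_assoc, add_sub_cancel_left]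
    linarith [hmem p hp t ht]
  have hend : ∀ p ∈ D, F a + m / 2 < F (a + p.1 + R • p.2) := by
    intro p hp
    have hRI : R ∈ Icc 0 R := right_mem_Icc.2 hR0.le
    have hnR : ‖R • p.2‖ = R := by rw [norm_smul, hp.2.2, mul_one, Real.norm_of_nonneg hR0.le]
    have h1 := h.le_apply (P.smul_mem R hp.2.1) (by
      rw [mem_ball, dist_eq_norm, add_sub_cancel_left, hnR]; linarith)
    rw [hnR, ← hm] at h1
    have h2 := hδ (a + p.1 + R • p.2) (by
      rw [mem_closedBall, dist_eq_norm, add_assoc, add_sub_cancel_left]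
      exact (hmem p hp R hRI).le) (a + R • p.2) (by
      rw [mem_closedBall, dist_eq_norm, add_sub_cancel_left, hnR]; linarith) (by
      rw [dist_eq_norm, show a + p.1 + R • p.2 - (a + R • p.2) = p.1 by abel]
      exact hp.1.2.trans_le hδ1)
    rw [Real.dist_eq] at h2
    have := (abs_lt.1 h2).1
    linarith
  have hstart : ∀ b ∈ Q, ‖b‖ < δ → F (a + b) ≤ F a := by
    intro b hb hbδ
    have := h.neg.le_apply hb (by rw [mem_ball, dist_eq_norm, add_sub_cancel_left]; linarith)
    have h0 : 0 ≤ c / 2 * ‖b‖ ^ 2 := by have := h.const_pos; positivity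
    linarith
  obtain ⟨T₁, T₂, hT₁, hT₂, hT⟩ := exists_isPreconnected_cover_sphere P
  obtain ⟨K, hK0, hK⟩ : ∃ K > 0, ∀ x, ‖π x‖ ≤ K * ‖x‖ :=
    ⟨‖π‖ + 1, by positivity, fun x => (π.le_opNorm x).trans
      (mul_le_mul_of_nonneg_right (by linarith) (norm_nonneg x))⟩
  -- With `K` bounding `π`, this radius forces `‖π v‖ < R` and `‖v - π v‖ < δ`, so every point of
  -- the small ball lies on one of the rays.
  refine ⟨min (R / K) (δ / (1 + K)), by positivity, m / 2, by positivity, fun w hw => ?_⟩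
  have hex : ∀ p ∈ D, ∃ t ∈ Ioo 0 R, F (a + p.1 + t • p.2) = w ∧
      (∀ s ∈ Icc 0 R, s < t → F (a + p.1 + s • p.2) < w) ∧
      ∀ s ∈ Icc 0 R, t < s → w < F (a + p.1 + s • p.2) := by
    intro p hp
    refine exists_crossing_of_convexOn (φ := fun t => F (a + p.1 + t • p.2)) hR0.le
      (h.convexOn_line hp.2.1 (hball p hp))
      (fun t ht => (hasDerivAt_line (h.differentiableAt _
        (hball p hp t ht))).continuousAt.continuousWithinAt) ?_ (by linarith [hend p hp, hw.2])
    simp only [zero_smul, add_zero]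
    linarith [hstart p.1 hp.1.1 hp.1.2, hw.1]
  choose! τ hτ hτw hτlt hτgt using hex
  have hτc : ContinuousOn τ D := by
    rw [continuousOn_iff_continuous_domRestrict]
    refine continuous_crossing (F := fun (p : D) t => F (a + p.1.1 + t • p.1.2))
      (fun p => hτ p p.2) (fun p => hτw p p.2) (fun p => hτlt p p.2) (fun p => hτgt p p.2)
      fun p t ht => ?_
    exact ContinuousAt.comp (f := fun p : D => a + p.1.1 + t • p.1.2)
      (hFc _ (hball p p.2 t (Ioo_subset_Icc_self ht))) (by fun_prop)
  set σ : E × E → E := fun p => a + p.1 + τ p • p.2 with hσ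
  have hσc : ContinuousOn σ D := by
    have := hτc
    fun_prop
  set N : Set E := {b | b ∈ Q ∧ ‖b‖ < δ} with hN
  have hNc : IsPreconnected N := by
    have : N = (Q : Set E) ∩ ball 0 δ := by ext; simp [hN]
    rw [this]
    exact (Q.convex.inter (convex_ball _ _)).isPreconnected
  have hND : N ×ˢ T₁ ∪ N ×ˢ T₂ = D := by
    rw [← prod_union, hT]
    rfl
  refine ⟨σ '' (N ×ˢ T₁), σ '' (N ×ˢ T₂), (hNc.prod hT₁).image _
    (hσc.mono (hND ▸ subset_union_left)), (hNc.prod hT₂).image _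
    (hσc.mono (hND ▸ subset_union_right)), ?_, ?_⟩
  · rw [← image_union, hND]
    rintro _ ⟨p, hp, rfl⟩
    exact ⟨hball p hp _ (Ioo_subset_Icc_self (hτ p hp)), hτw p hp⟩
  · rw [← image_union, hND]
    rintro x ⟨hx, hxw⟩
    have hxw' : F x = w := hxw
    rw [mem_ball, dist_eq_norm, lt_min_iff, lt_div_iff₀ hK0,
      lt_div_iff₀ (show 0 < 1 + K by positivity)] at hx
    set v := x - a with hv
    have hx1 : ‖π v‖ < R := (hK v).trans_lt (by linarith [hx.1])
    have hx2 : ‖v - π v‖ < δ := (norm_sub_le _ _).trans_lt (by linarith [hK v, hx.2])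
    have hxa : x = a + (v - π v) + π v := by rw [hv]; abel
    -- Otherwise `x` would lie in `a + Q`, where `F ≤ F a < w`.
    have hπ0 : π v ≠ 0 := by
      intro h0
      have := hstart _ (hπQ v) hx2
      rw [h0, add_zero] at hxa
      rw [h0, ← hxa] at this
      linarith [hw.1]
    have hs0 : 0 < ‖π v‖ := norm_pos_iff.2 hπ0
    have hpD : (v - π v, ‖π v‖⁻¹ • π v) ∈ D := ⟨⟨hπQ v, hx2⟩, P.smul_mem _ (hπP v), by
      rw [norm_smul, norm_inv, norm_norm, inv_mul_cancel₀ hs0.ne']⟩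
    have hxs : a + (v - π v) + ‖π v‖ • ‖π v‖⁻¹ • π v = x := by
      rw [smul_inv_smul₀ hs0.ne']; exact hxa.symm
    have hsR : ‖π v‖ ∈ Icc 0 R := ⟨hs0.le, hx1.le⟩
    refine ⟨_, hpD, ?_⟩
    have : τ (v - π v, ‖π v‖⁻¹ • π v) = ‖π v‖ := by
      rcases lt_trichotomy (τ (v - π v, ‖π v‖⁻¹ • π v)) ‖π v‖ with h' | h' | h'
      · have := hτgt _ hpD _ hsR h'
        simp only [hxs] at this
        linarith
      · exact h'
      · have := hτlt _ hpD _ hsR h'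
        simp only [hxs] at this
        linarith
    simp only [hσ, this]
    exact hxs

end Saddle
end MorseLevel

/-! ### Counting components -/

namespace MorseLevel
open Set Filter Metric

section Components

variable {M : Type*} [TopologicalSpace M]

/-- Two points of a preconnected subset of `A` lie in the same component of `A`. -/
theorem connectedComponents_mk_eq {A C : Set M} (hC : IsPreconnected C) (hCA : C ⊆ A) {x y : A}
    (hx : (x : M) ∈ C) (hy : (y : M) ∈ C) :
    (x : ConnectedComponents A) = (y : ConnectedComponents A) := by
  rw [ConnectedComponents.coe_eq_coe]
  refine connectedComponent_eq ?_
  have h1 : IsPreconnected ((↑) ⁻¹' C : Set A) := by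
    rw [← Topology.IsInducing.subtypeVal.isPreconnected_image, Subtype.image_preimage_coe,
      inter_eq_right.2 hCA]
    exact hC
  exact h1.subset_connectedComponent hx hy

theorem subsingleton_mk_image {A C : Set M} (hC : IsPreconnected C) (hCA : C ⊆ A) :
    ((fun x : A => (x : ConnectedComponents A)) '' ((↑) ⁻¹' C)).Subsingleton := by
  rintro _ ⟨x, hx, rfl⟩ _ ⟨y, hy, rfl⟩
  exact connectedComponents_mk_eq hC hCA hx hy

theorem mk_image_subset {A U C₁ C₂ : Set M} (hU : U ∩ A ⊆ C₁ ∪ C₂) :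
    (fun x : A => (x : ConnectedComponents A)) '' ((↑) ⁻¹' U) ⊆
      ((fun x : A => (x : ConnectedComponents A)) '' ((↑) ⁻¹' C₁)) ∪
      ((fun x : A => (x : ConnectedComponents A)) '' ((↑) ⁻¹' C₂)) := by
  rw [← image_union]
  exact image_mono fun x hx => hU ⟨hx, x.2⟩

/-- `A ∩ U` is contained in the union of two preconnected subsets of `A`. -/
def HasTwoPieces (A U : Set M) : Prop :=
  ∃ C₁ C₂ : Set M, IsPreconnected C₁ ∧ IsPreconnected C₂ ∧ C₁ ∪ C₂ ⊆ A ∧ U ∩ A ⊆ C₁ ∪ C₂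

theorem HasTwoPieces.finite {A U : Set M} (h : HasTwoPieces A U) :
    ((fun x : A => (x : ConnectedComponents A)) '' ((↑) ⁻¹' U)).Finite := by
  obtain ⟨C₁, C₂, h₁, h₂, hsub, hU⟩ := h
  exact ((subsingleton_mk_image h₁ (subset_union_left.trans hsub)).finite.union
    (subsingleton_mk_image h₂ (subset_union_right.trans hsub)).finite).subset (mk_image_subset hU)

theorem HasTwoPieces.ncard_le {A U : Set M} (h : HasTwoPieces A U) :
    ((fun x : A => (x : ConnectedComponents A)) '' ((↑) ⁻¹' U)).ncard ≤ 2 := by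
  obtain ⟨C₁, C₂, h₁, h₂, hsub, hU⟩ := h
  have s₁ := subsingleton_mk_image h₁ (subset_union_left.trans hsub)
  have s₂ := subsingleton_mk_image h₂ (subset_union_right.trans hsub)
  have hle := ncard_le_ncard (mk_image_subset hU) (s₁.finite.union s₂.finite)
  have hle2 := ncard_union_le ((fun x : A => (x : ConnectedComponents A)) '' ((↑) ⁻¹' C₁))
    ((fun x : A => (x : ConnectedComponents A)) '' ((↑) ⁻¹' C₂))
  have l₁ := (ncard_le_one s₁.finite).2 fun a ha b hb => s₁ ha hb
  have l₂ := (ncard_le_one s₂.finite).2 fun a ha b hb => s₂ ha hb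
  omega

theorem finite_connectedComponents {A : Set M} (hA : IsCompact A)
    (h : ∀ x ∈ A, ∃ U, IsOpen U ∧ x ∈ U ∧ HasTwoPieces A U) : Finite (ConnectedComponents A) := by
  choose! U hUo hxU hU using h
  obtain ⟨t, htA, htU⟩ := hA.elim_nhds_subcover U fun x hx => (hUo x hx).mem_nhds (hxU x hx)
  have hfin : (⋃ x ∈ t, (fun x : A => (x : ConnectedComponents A)) '' ((↑) ⁻¹' U x)).Finite :=
    t.finite_toSet.biUnion fun x hx => (hU x (htA x hx)).finite
  rw [← finite_univ_iff]
  refine hfin.subset fun c _ => ?_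
  obtain ⟨x, rfl⟩ := ConnectedComponents.surjective_coe c
  obtain ⟨y, hy, hxy⟩ := mem_iUnion₂.1 (htU x.2)
  exact mem_iUnion₂.2 ⟨y, hy, x, hxy, rfl⟩

/-- If `X` and `Y` agree on the open set `O` and two connected pieces of `X` cover the rest, then
`X` has at most two components more than `Y`. -/
theorem card_connectedComponents_le {X Y B O : Set M} (hX : IsClosed X)
    [Finite (ConnectedComponents X)] [Finite (ConnectedComponents Y)] (hO : IsOpen O)
    (hXY : X ∩ O = Y ∩ O) (hBO : Bᶜ ⊆ O) (hB : HasTwoPieces X B) :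
    Nat.card (ConnectedComponents X) ≤ Nat.card (ConnectedComponents Y) + 2 := by
  set S := (fun x : X => (x : ConnectedComponents X)) '' ((↑) ⁻¹' B) with hS
  have hout : ∀ c ∈ Sᶜ, ∀ x : X, (x : ConnectedComponents X) = c → (x : M) ∈ O := by
    intro c hc x hx
    exact hBO fun hxB => hc ⟨x, hxB, hx⟩
  choose ξ hξ using ConnectedComponents.surjective_coe (α := X)
  have hmem : ∀ c ∈ Sᶜ, (ξ c : M) ∈ Y := fun c hc =>
    (hXY.subset ⟨(ξ c).2, hout c hc _ (hξ c)⟩).1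
  -- A component of `X` that avoids `B` lies in `O`, hence in `Y`, and is sent to the component of
  -- `Y` through one of its points. At most two components remain in `S`.
  let ψ : ↥Sᶜ → ConnectedComponents Y := fun c => ((⟨ξ c, hmem c c.2⟩ : Y) : ConnectedComponents Y)
  have hψ : Function.Injective ψ := by
    intro c d hcd
    have hclopen : IsClopen ((fun x : X => (x : ConnectedComponents X)) ⁻¹' {(c : ConnectedComponents X)}) :=
      (isClopen_discrete _).preimage ConnectedComponents.continuous_coe
    -- The component `c` viewed inside `Y`. It is clopen there: closed because `X` is closed, open
    -- because it lies in `O`, where `X` and `Y` agree. A component of `Y` meeting `Z` thus stays in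
    -- `Z`, which gives injectivity.
    set Z : Set Y :=
      (↑) ⁻¹' (Subtype.val '' ((fun x : X => (x : ConnectedComponents X)) ⁻¹' {(c : ConnectedComponents X)})) with hZ
    have hZcl : IsClosed Z :=
      (hX.isClosedMap_subtype_val _ hclopen.1).preimage continuous_subtype_val
    have hZop : IsOpen Z := by
      obtain ⟨O₁, hO₁, hO₁c⟩ := isOpen_induced_iff.1 hclopen.2
      have : Z = (↑) ⁻¹' (O₁ ∩ O) := by
        ext y
        simp only [hZ, ← hO₁c, mem_preimage, mem_image, mem_inter_iff]
        constructor
        · rintro ⟨x, hx, hxy⟩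
          rw [← hxy]
          refine ⟨hx, hout c c.2 x ?_⟩
          have : x ∈ (Subtype.val ⁻¹' O₁ : Set X) := hx
          rw [hO₁c] at this
          exact this
        · rintro ⟨h1, h2⟩
          exact ⟨⟨y, (hXY.superset ⟨y.2, h2⟩).1⟩, h1, rfl⟩
      rw [this]
      exact (hO₁.inter hO).preimage continuous_subtype_val
    have hcZ : (⟨ξ c, hmem c c.2⟩ : Y) ∈ Z := ⟨ξ c, hξ c, rfl⟩
    have hdZ : (⟨ξ d, hmem d d.2⟩ : Y) ∈ Z := by
      refine IsClopen.connectedComponent_subset ⟨hZcl, hZop⟩ hcZ ?_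
      rw [ConnectedComponents.coe_eq_coe.1 hcd]
      exact mem_connectedComponent
    obtain ⟨x, hx, hxd⟩ := hdZ
    have hxd' : x = ξ d := Subtype.ext hxd
    have hx' : (x : ConnectedComponents X) = c := hx
    rw [hxd', hξ] at hx'
    exact Subtype.ext hx'.symm
  have h1 := Nat.card_le_card_of_injective ψ hψ
  have h2 := hB.ncard_le
  have h3 := ncard_add_ncard_compl S
  rw [← Nat.card_coe_set_eq Sᶜ] at h3
  rw [← hS] at h2
  omega

theorem card_connectedComponents_le_of_surjective {X Y : Type*} [TopologicalSpace X]
    [TopologicalSpace Y] [Finite (ConnectedComponents X)] {g : X → Y} (hg : Continuous g)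
    (hs : Function.Surjective g) : Finite (ConnectedComponents Y) ∧
      Nat.card (ConnectedComponents Y) ≤ Nat.card (ConnectedComponents X) :=
  ⟨Finite.of_surjective _ (hg.connectedComponentsMap_surjective hs),
    Nat.card_le_card_of_surjective _ (hg.connectedComponentsMap_surjective hs)⟩

end Components

section Level

variable {n : ℕ} {M : Type*} [TopologicalSpace M]
  [ChartedSpace (EuclideanSpace ℝ (Fin n)) M]

/-- Level sets are locally connected near noncritical points. -/
theorem hasTwoPieces_of_not_isCriticalPoint [IsManifold (𝓡 n) ∞ M] {f : M → ℝ}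
    (hf : ContMDiff (𝓡 n) 𝓘(ℝ, ℝ) 1 f) {q : M} (hq : ¬ IsCriticalPoint n f q) :
    ∃ U, IsOpen U ∧ q ∈ U ∧ HasTwoPieces (levelSet f (f q)) U := by
  obtain ⟨r, V, h⟩ := exists_isLineChart hf hq
  have hr := h.pos
  set φ := extChartAt (𝓡 n) q with hφ
  set F := inCoordinates n f q with hFdef
  set w := f q with hw
  have hf' : ContMDiff (𝓡 n) 𝓘(ℝ, ℝ) (1 : ℕ∞) f := hf
  have hFc : ∀ z ∈ closedBall (φ q) (3 * r), ContDiffAt ℝ 1 F z := fun z hz =>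
    contDiffAt_inCoordinates hf' (h.subset_target hz)
  have hin : ∀ z ∈ ball (φ q) (2 * r), ∀ t ∈ Icc (-r) r,
      z + t • V ∈ closedBall (φ q) (3 * r) := fun z hz t ht =>
    ball_subset_closedBall (by convert! h.add_smul_mem hz ht using 2; ring)
  have h0 : φ q ∈ ball (φ q) (2 * r) := mem_ball_self (by positivity)
  have hrI : r ∈ Icc (-r) r := ⟨by linarith, le_rfl⟩
  have hrI' : -r ∈ Icc (-r) r := ⟨le_rfl, by linarith⟩
  have h0I : (0 : ℝ) ∈ Icc (-r) r := ⟨by linarith, hr.le⟩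
  have hmono := strictMonoOn_line (G := F) (x := φ q) (V := V) (a := -r) (b := r)
    (fun t ht => (hFc _ (hin _ h0 t ht)).differentiableAt one_ne_zero)
    fun t ht => h.deriv_pos _ (hin _ h0 t ht)
  have hF0 : F (φ q) = w := inCoordinates_self f q
  have hm : F (φ q + (-r) • V) < w := by
    have := hmono hrI' h0I (by linarith)
    simpa only [zero_smul, add_zero, hF0] using this
  have hp : w < F (φ q + r • V) := by
    have := hmono h0I hrI hr
    simpa only [zero_smul, add_zero, hF0] using this
  have hcont : ∀ t ∈ Icc (-r) r, ContinuousAt (fun z => F (z + t • V)) (φ q) := fun t ht =>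
    ContinuousAt.comp (f := fun z => z + t • V) (hFc _ (hin _ h0 t ht)).continuousAt (by fun_prop)
  obtain ⟨δ, hδ, hS⟩ := Metric.mem_nhds_iff.1 (inter_mem (isOpen_ball.mem_nhds h0)
    (inter_mem ((hcont _ hrI').eventually (gt_mem_nhds hm))
      ((hcont _ hrI).eventually (lt_mem_nhds hp))))
  -- Sliding a small ball along `V` onto the level gives one connected piece; it fixes points
  -- already on the level, so it covers them. The second piece is empty.
  obtain ⟨τ, hτ, hτc, -⟩ := exists_lineTime (G := fun _ => w) (G' := F) (V := V) hr
    (isOpen_ball (x := φ q) (ε := δ)) (fun z hz t ht => hFc _ (hin z (hS hz).1 t ht))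
    (fun z hz t ht => h.deriv_pos _ (hin z (hS hz).1 t ht)) (fun z hz => (hS hz).2.1)
    fun z hz => (hS hz).2.2
  have hτc := hτc continuousOn_const
  have htarget : ∀ z ∈ ball (φ q) δ, z + τ z • V ∈ φ.target := fun z hz =>
    h.subset_target (hin z (hS hz).1 _ (Ioo_subset_Icc_self (hτ z hz).1))
  refine ⟨chartBall n q δ, isOpen_chartBall q δ, mem_chartBall_self q hδ,
    (fun z => φ.symm (z + τ z • V)) '' ball (φ q) δ, ∅, ?_, isPreconnected_empty, ?_, ?_⟩
  · refine (convex_ball _ _).isPreconnected.image _ ?_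
    exact (continuousOn_extChartAt_symm q).comp (continuousOn_id.add
      (hτc.smul continuousOn_const)) htarget
  · rw [union_empty]
    rintro _ ⟨z, hz, rfl⟩
    exact (hτ z hz).2.1
  · rw [union_empty]
    rintro x ⟨hx, hxw⟩
    refine ⟨φ x, hx.2, ?_⟩
    have : F (φ x) = w := (inCoordinates_apply hx.1).trans hxw
    have hτ0 := (hτ _ hx.2).2.2 0 h0I (by rw [zero_smul, add_zero, this])
    change φ.symm (φ x + τ (φ x) • V) = x
    rw [← hτ0, zero_smul, add_zero]
    exact φ.left_inv hx.1

/-- A Morse function is a saddle in the preferred coordinates at a critical point. -/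
theorem IsMorse.exists_isSaddle [IsManifold (𝓡 n) ∞ M] {f : M → ℝ} (hf : IsMorse n f) {p : M}
    (hp : IsCriticalPoint n f p) :
    ∃ (P Q : Submodule ℝ (EuclideanSpace ℝ (Fin n)))
      (π : EuclideanSpace ℝ (Fin n) →L[ℝ] EuclideanSpace ℝ (Fin n)) (ρ c : ℝ),
      IsSaddle (inCoordinates n f p) (extChartAt (𝓡 n) p p) ρ c P Q ∧
      closedBall (extChartAt (𝓡 n) p p) ρ ⊆ (extChartAt (𝓡 n) p).target ∧
      (∀ x, π x ∈ P) ∧ (∀ x, x - π x ∈ Q) ∧ (morseIndex n f p = 0 → P = ⊤) := by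
  have hf2 : ContMDiff (𝓡 n) 𝓘(ℝ, ℝ) (2 : ℕ∞) f := hf.contMDiff
  have hF : ContDiffAt ℝ 2 (inCoordinates n f p) (extChartAt (𝓡 n) p p) :=
    contDiffAt_inCoordinates hf2 (mem_extChartAt_target p)
  obtain ⟨P, Q, π, c, hc, h1, h2, h3, h4, h5⟩ := exists_splitting
    (fderiv ℝ (fderiv ℝ (inCoordinates n f p)) (extChartAt (𝓡 n) p p))
    (fun x y => hF.isSymmSndFDerivAt (by simp) x y) (A := hessianMatrix n f p)
    (fun i j => rfl) (hf.nondegenerate p hp)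
  obtain ⟨ρ, hρ, hs⟩ := MorseLevel.exists_isSaddle hF rfl
    ((isCriticalPoint_iff (hf.contMDiff.of_le one_le_two) p).1 hp) hc h3 h4
  obtain ⟨ρ', hρ', hsub⟩ := exists_closedBall_subset_target (n := n) p
  exact ⟨P, Q, π, min ρ ρ', c / 2, hs.mono_radius (lt_min hρ hρ') (min_le_left _ _),
    (closedBall_subset_closedBall (min_le_right _ _)).trans hsub, h1, h2, h5⟩

theorem hasTwoPieces_of_chart {f : M → ℝ} {p : M} {ρ r w : ℝ}
    (hsub : closedBall (extChartAt (𝓡 n) p p) ρ ⊆ (extChartAt (𝓡 n) p).target)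
    {C₁ C₂ : Set (EuclideanSpace ℝ (Fin n))} (h₁ : IsPreconnected C₁) (h₂ : IsPreconnected C₂)
    (hC : C₁ ∪ C₂ ⊆ ball (extChartAt (𝓡 n) p p) ρ ∩ inCoordinates n f p ⁻¹' {w})
    (hcov : ball (extChartAt (𝓡 n) p p) r ∩ inCoordinates n f p ⁻¹' {w} ⊆ C₁ ∪ C₂) :
    HasTwoPieces (levelSet f w) (chartBall n p r) := by
  have hcont : ContinuousOn (extChartAt (𝓡 n) p).symm (C₁ ∪ C₂) :=
    (continuousOn_extChartAt_symm p).mono fun z hz => hsub (ball_subset_closedBall (hC hz).1)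
  refine ⟨(extChartAt (𝓡 n) p).symm '' C₁, (extChartAt (𝓡 n) p).symm '' C₂,
    h₁.image _ (hcont.mono subset_union_left), h₂.image _ (hcont.mono subset_union_right), ?_, ?_⟩
  · rw [← image_union]
    rintro _ ⟨z, hz, rfl⟩
    exact (hC hz).2
  · rw [← image_union]
    rintro x ⟨hx, hxw⟩
    exact ⟨_, hcov ⟨hx.2, (inCoordinates_apply hx.1).trans hxw⟩, (extChartAt (𝓡 n) p).left_inv hx.1⟩

/-- Near a nondegenerate critical point, the nearby level sets are covered by two connected
pieces. -/
theorem IsMorse.exists_hasTwoPieces [IsManifold (𝓡 n) ∞ M] {f : M → ℝ} (hf : IsMorse n f) {p : M}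
    (hp : IsCriticalPoint n f p) :
    ∃ r > 0, closedBall (extChartAt (𝓡 n) p p) r ⊆ (extChartAt (𝓡 n) p).target ∧
      ∃ ε₀ > 0, ∀ w, w ≠ f p → |w - f p| < ε₀ →
        HasTwoPieces (levelSet f w) (chartBall n p r) := by
  obtain ⟨P, Q, π, ρ, c, hs, hsub, hP, hQ, -⟩ := hf.exists_isSaddle hp
  obtain ⟨r₁, hr₁, ε₁, hε₁, h₁⟩ := hs.exists_isPreconnected_cover π hP hQ
  -- Levels below the critical one are levels of `-F` above it, with `P` and `Q` exchanged.
  obtain ⟨r₂, hr₂, ε₂, hε₂, h₂⟩ := hs.neg.exists_isPreconnected_cover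
    (ContinuousLinearMap.id ℝ _ - π) (fun x => by simpa using hQ x) (fun x => by simpa using hP x)
  rw [inCoordinates_self] at h₁ h₂
  have hpos := hs.pos
  refine ⟨min ρ (min r₁ r₂), by positivity,
    (closedBall_subset_closedBall (min_le_left _ _)).trans hsub, min ε₁ ε₂, by positivity,
    fun w hne hw => ?_⟩
  rw [abs_lt, neg_lt, lt_min_iff, lt_min_iff] at hw
  rcases hne.lt_or_gt with hlt | hgt
  · obtain ⟨C₁, C₂, c₁, c₂, hC, hcov⟩ := h₂ (-w) ⟨by linarith, by linarith [hw.1.2]⟩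
    refine hasTwoPieces_of_chart hsub c₁ c₂ (fun z hz => ?_) fun z hz => ?_
    · exact ⟨(hC hz).1, neg_injective (hC hz).2⟩
    · exact hcov ⟨ball_subset_ball ((min_le_right _ _).trans (min_le_right _ _)) hz.1,
        congrArg Neg.neg hz.2⟩
  · obtain ⟨C₁, C₂, c₁, c₂, hC, hcov⟩ := h₁ w ⟨hgt, by linarith [hw.2.1]⟩
    refine hasTwoPieces_of_chart hsub c₁ c₂ hC fun z hz => ?_
    exact hcov ⟨ball_subset_ball ((min_le_right _ _).trans (min_le_left _ _)) hz.1, hz.2⟩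

end Level
end MorseLevel

/-! ### Change of the number of components at a critical level -/

namespace MorseLevel
open Set Filter Metric

section Level

variable {n : ℕ} {M : Type*} [TopologicalSpace M]
  [ChartedSpace (EuclideanSpace ℝ (Fin n)) M]

/-- Here `ε` may have either sign, so one inequality applied to `ε` and `-ε` bounds the difference
both ways. -/
theorem exists_card_connectedComponents_le [T2Space M] [CompactSpace M] [IsManifold (𝓡 n) ∞ M]
    {f : M → ℝ} (hf : IsMorse n f) {u : ℝ} {p : M} (hpu : f p = u) (hp : IsCriticalPoint n f p)
    (huniq : ∀ q, f q = u → IsCriticalPoint n f q → q = p) :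
    ∃ ε₀ > 0, ∀ ε : ℝ, ε ≠ 0 → |ε| < ε₀ →
      Finite (ConnectedComponents (levelSet f (u + ε))) ∧
      (Finite (ConnectedComponents (levelSet f (u - ε))) →
        b0 (levelSet f (u + ε)) ≤ b0 (levelSet f (u - ε)) + 2) := by
  have hf1 : ContMDiff (𝓡 n) 𝓘(ℝ, ℝ) (1 : ℕ∞) f := hf.contMDiff.of_le one_le_two
  have hfc : Continuous f := hf.contMDiff.continuous
  obtain ⟨r, hr, hsub, ε₁, hε₁, hpieces⟩ := hf.exists_hasTwoPieces hp
  rw [hpu] at hpieces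
  obtain ⟨η, hη, hband⟩ := exists_band hf1 (u := u) (isOpen_chartBall (n := n) p (r / 2))
    fun x hx hc => by
      rw [huniq x hx hc]
      exact mem_chartBall_self p (half_pos hr)
  obtain ⟨χ, hχ, -, hχ01, ε₂, hε₂, hΦ⟩ := exists_sweep le_rfl hf1
    (s := {x | |f x - u| ≤ η} ∩ (chartBall n p (r / 2))ᶜ)
    ((isClosed_le (by fun_prop) continuous_const).inter (isOpen_chartBall p _).isClosed_compl)
    isOpen_univ (subset_univ _) fun x hx => hband x hx.1 hx.2
  -- The sweep by `2 ε` moves values by at most `2 |ε|` from the level `u - ε`; as `3 |ε| < η`, they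
  -- stay in the band.
  refine ⟨min (min ε₁ (η / 3)) (ε₂ / 2), by positivity, fun ε hε0 hε => ?_⟩
  rw [lt_min_iff, lt_min_iff] at hε
  obtain ⟨⟨hεa, hεb⟩, hεc⟩ := hε
  have hpieces' : HasTwoPieces (levelSet f (u + ε)) (chartBall n p r) :=
    hpieces _ (by simpa using hε0) (by simpa using hεa)
  have hfin : Finite (ConnectedComponents (levelSet f (u + ε))) := by
    refine finite_connectedComponents (isClosed_eq hfc continuous_const).isCompact fun x hx => ?_
    have hx' : f x = u + ε := hx
    by_cases hxB : x ∈ chartBall n p r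
    · exact ⟨_, isOpen_chartBall p r, hxB, hpieces'⟩
    · rw [← hx']
      refine hasTwoPieces_of_not_isCriticalPoint hf1 (hband x ?_ fun h => hxB
        (chartBall_subset_chartBall p (by linarith) h))
      rw [hx', add_sub_cancel_left]
      linarith
  refine ⟨hfin, fun hfin' => ?_⟩
  obtain ⟨Φ, h⟩ := hΦ (2 * ε) (by rw [abs_mul, abs_two]; linarith)
  have hO : IsOpen (chartClosedBall n p (r / 2))ᶜ :=
    (isCompact_chartClosedBall p ((closedBall_subset_closedBall (by linarith)).trans
      hsub)).isClosed.isOpen_compl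
  -- The image of the level `u - ε` under the sweep; off the half ball, where `χ = 1` on the band,
  -- it is the level `u + ε`.
  set Y : Set M := {x | f x - 2 * ε * χ x = u - ε} with hY
  have hYΦ : ∀ x, x ∈ levelSet f (u - ε) → Φ x ∈ Y := fun x hx => (h x).trans hx
  let g : levelSet f (u - ε) → Y := fun x => ⟨Φ x, hYΦ x x.2⟩
  have hg : Continuous g := (Φ.continuous.comp continuous_subtype_val).subtype_mk _
  have hgs : Function.Surjective g := by
    rintro ⟨y, hy⟩
    have hy' := h (Φ.symm y)
    rw [Φ.apply_symm_apply] at hy'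
    have hy2 : f y - 2 * ε * χ y = u - ε := hy
    exact ⟨⟨Φ.symm y, hy'.symm.trans hy2⟩, Subtype.ext (Φ.apply_symm_apply y)⟩
  obtain ⟨hYfin, hYcard⟩ := card_connectedComponents_le_of_surjective hg hgs
  have hb : ∀ x, |2 * ε * χ x| ≤ 2 * |ε| := fun x => by
    rw [abs_mul, abs_mul, abs_two, abs_of_nonneg (hχ01 x).1]
    exact mul_le_of_le_one_right (by positivity) (hχ01 x).2
  have habs := abs_le.1 (le_refl |ε|)
  have hXY : levelSet f (u + ε) ∩ (chartClosedBall n p (r / 2))ᶜ =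
      Y ∩ (chartClosedBall n p (r / 2))ᶜ := by
    ext x
    refine and_congr_left fun hxO => ?_
    have hxO' : x ∈ (chartBall n p (r / 2))ᶜ := fun h' => hxO (chartBall_subset_chartClosedBall p _ h')
    simp only [levelSet, hY, mem_ofPred_eq]
    constructor
    · intro hx
      rw [hχ x ⟨?_, hxO'⟩]
      · linarith
      · rw [mem_ofPred_eq, hx, add_sub_cancel_left]
        linarith
    · intro hx
      have := hχ x ⟨?_, hxO'⟩
      · rw [this] at hx
        linarith
      · rw [mem_ofPred_eq, abs_le]
        have := abs_le.1 (hb x)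
        constructor <;> linarith
  have := card_connectedComponents_le (X := levelSet f (u + ε)) (isClosed_eq hfc continuous_const) hO hXY
    (fun x hx hx' => hx (chartClosedBall_subset_chartBall p (by linarith) hx')) hpieces'
  exact this.trans (Nat.add_le_add_right hYcard 2)

theorem eventually_abs_b0_sub_le [T2Space M] [CompactSpace M] [IsManifold (𝓡 n) ∞ M]
    {f : M → ℝ} (hf : IsMorse n f) {u : ℝ} {p : M} (hpu : f p = u) (hp : IsCriticalPoint n f p)
    (huniq : ∀ q, f q = u → IsCriticalPoint n f q → q = p) :
    ∀ᶠ ε in 𝓝[>] (0 : ℝ),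
      Finite (ConnectedComponents (levelSet f (u + ε))) ∧
      Finite (ConnectedComponents (levelSet f (u - ε))) ∧
      |(b0 (levelSet f (u + ε)) : ℤ) - (b0 (levelSet f (u - ε)) : ℤ)| ≤ 2 := by
  obtain ⟨ε₀, hε₀, h⟩ := exists_card_connectedComponents_le hf hpu hp huniq
  filter_upwards [Ioo_mem_nhdsGT hε₀] with ε hε
  obtain ⟨hfin, hle⟩ := h ε hε.1.ne' (by rw [abs_of_pos hε.1]; exact hε.2)
  obtain ⟨hfin', hle'⟩ := h (-ε) (neg_ne_zero.2 hε.1.ne')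
    (by rw [abs_neg, abs_of_pos hε.1]; exact hε.2)
  rw [← sub_eq_add_neg] at hfin' hle'
  rw [sub_neg_eq_add] at hle'
  have h1 := hle hfin'
  have h2 := hle' hfin
  refine ⟨hfin, hfin', ?_⟩
  rw [abs_le]
  omega

end Level
end MorseLevel

/-! ### Birth of a sphere at a minimum -/

namespace MorseLevel
open Set Filter Metric

section Glue

variable {n : ℕ} {M N : Type*} [TopologicalSpace M]
  [ChartedSpace (EuclideanSpace ℝ (Fin n)) M] [TopologicalSpace N]
  [ChartedSpace (EuclideanSpace ℝ (Fin n)) N]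

/-- The union of two separated subsets is diffeomorphic to the disjoint union of two subsets
diffeomorphic to them. -/
theorem SubsetsDiffeomorphic.union_disjointUnion {L : Type*} [TopologicalSpace L]
    [ChartedSpace (EuclideanSpace ℝ (Fin n)) L] {k : ℕ∞} {A' B' U V : Set L} {A : Set M} {B : Set N}
    (hA : SubsetsDiffeomorphic n n k A' A) (hB : SubsetsDiffeomorphic n n k B' B)
    (hU : IsOpen U) (hV : IsOpen V) (hUV : Disjoint U V) (hAU : A' ⊆ U) (hBV : B' ⊆ V) :
    SubsetsDiffeomorphic n n k (A' ∪ B') (disjointUnion A B) := by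
  classical
  obtain ⟨e, he, he'⟩ := hA
  obtain ⟨g, hg, hg'⟩ := hB
  have hdisj : Disjoint A' B' := hUV.mono hAU hBV
  have hdisj' : Disjoint (Sum.inl '' A : Set (M ⊕ N)) (Sum.inr '' B) := by
    rw [disjoint_left]
    rintro _ ⟨x, -, rfl⟩ ⟨y, -, h⟩
    cases h
  let E : ↥(A' ∪ B') ≃ disjointUnion A B := (Equiv.Set.union hdisj).trans
    ((e.sumCongr g).trans (((Equiv.Set.image Sum.inl A Sum.inl_injective).sumCongr
      (Equiv.Set.image Sum.inr B Sum.inr_injective)).trans (Equiv.Set.union hdisj').symm))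
  have hEl : ∀ (x : ↥(A' ∪ B')) (hx : (x : L) ∈ A'), (E x : M ⊕ N) = Sum.inl (e ⟨x, hx⟩ : M) := by
    intro x hx
    simp only [E, Equiv.trans_apply, Equiv.Set.union_apply_left hdisj hx, Equiv.sumCongr_apply,
      Sum.map_inl]
    rfl
  have hEr : ∀ (x : ↥(A' ∪ B')) (hx : (x : L) ∈ B'), (E x : M ⊕ N) = Sum.inr (g ⟨x, hx⟩ : N) := by
    intro x hx
    simp only [E, Equiv.trans_apply, Equiv.Set.union_apply_right hdisj hx, Equiv.sumCongr_apply,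
      Sum.map_inr]
    rfl
  have hEl' : ∀ (y : disjointUnion A B) (a : M) (ha : a ∈ A), (y : M ⊕ N) = Sum.inl a →
      (E.symm y : L) = e.symm ⟨a, ha⟩ := by
    intro y a ha hy
    have : y = E ⟨e.symm ⟨a, ha⟩, Or.inl (e.symm ⟨a, ha⟩).2⟩ := by
      refine Subtype.ext ?_
      rw [hEl _ (e.symm ⟨a, ha⟩).2, hy]
      simp
    rw [this, Equiv.symm_apply_apply]
  have hEr' : ∀ (y : disjointUnion A B) (b : N) (hb : b ∈ B), (y : M ⊕ N) = Sum.inr b →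
      (E.symm y : L) = g.symm ⟨b, hb⟩ := by
    intro y b hb hy
    have : y = E ⟨g.symm ⟨b, hb⟩, Or.inr (g.symm ⟨b, hb⟩).2⟩ := by
      refine Subtype.ext ?_
      rw [hEr _ (g.symm ⟨b, hb⟩).2, hy]
      simp
    rw [this, Equiv.symm_apply_apply]
  refine ⟨E, ?_, ?_⟩
  · rintro ⟨x, hx | hx⟩
    · obtain ⟨O, hO, hxO, G, hG, hGe⟩ := he ⟨x, hx⟩
      refine ⟨O ∩ U, hO.inter hU, ⟨hxO, hAU hx⟩, Sum.inl ∘ G,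
        ContMDiff.inl.comp_contMDiffOn (hG.mono inter_subset_left), ?_⟩
      rintro ⟨y, hy | hy⟩ ⟨hyO, hyU⟩
      · exact (congrArg Sum.inl (hGe ⟨y, hy⟩ hyO)).trans (hEl ⟨y, _⟩ hy).symm
      · exact absurd (hBV hy) (disjoint_left.1 hUV hyU)
    · obtain ⟨O, hO, hxO, G, hG, hGe⟩ := hg ⟨x, hx⟩
      refine ⟨O ∩ V, hO.inter hV, ⟨hxO, hBV hx⟩, Sum.inr ∘ G,
        ContMDiff.inr.comp_contMDiffOn (hG.mono inter_subset_left), ?_⟩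
      rintro ⟨y, hy | hy⟩ ⟨hyO, hyV⟩
      · exact absurd hyV (disjoint_left.1 hUV (hAU hy))
      · exact (congrArg Sum.inr (hGe ⟨y, hy⟩ hyO)).trans (hEr ⟨y, _⟩ hy).symm
  · rintro ⟨_, ⟨a, ha, rfl⟩ | ⟨b, hb, rfl⟩⟩
    · obtain ⟨O, hO, haO, G, hG, hGe⟩ := he' ⟨a, ha⟩
      -- A smooth retraction onto the left summand; its value on the other summand is irrelevant, as
      -- only the open image of `O` is used.
      have hpr : ContMDiff (𝓡 n) (𝓡 n) k (Sum.elim id fun _ => a : M ⊕ N → M) :=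
        contMDiff_id.sumElim contMDiff_const
      refine ⟨Sum.inl '' O, isOpenMap_inl _ hO, ⟨a, haO, rfl⟩, G ∘ Sum.elim id fun _ => a,
        hG.comp hpr.contMDiffOn ?_, ?_⟩
      · rintro _ ⟨y, hy, rfl⟩
        exact hy
      · rintro ⟨_, ⟨y, hy, rfl⟩ | ⟨y, hy, rfl⟩⟩ ⟨z, hz, hzy⟩
        · cases hzy
          exact (hGe ⟨y, hy⟩ hz).trans (hEl' ⟨_, _⟩ y hy rfl).symm
        · cases hzy
    · obtain ⟨O, hO, hbO, G, hG, hGe⟩ := hg' ⟨b, hb⟩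
      have hpr : ContMDiff (𝓡 n) (𝓡 n) k (Sum.elim (fun _ => b) id : M ⊕ N → N) :=
        contMDiff_const.sumElim contMDiff_id
      refine ⟨Sum.inr '' O, isOpenMap_inr _ hO, ⟨b, hbO, rfl⟩, G ∘ Sum.elim (fun _ => b) id,
        hG.comp hpr.contMDiffOn ?_, ?_⟩
      · rintro _ ⟨y, hy, rfl⟩
        exact hy
      · rintro ⟨_, ⟨y, hy, rfl⟩ | ⟨y, hy, rfl⟩⟩ ⟨z, hz, hzy⟩
        · cases hzy
        · cases hzy
          exact (hGe ⟨y, hy⟩ hz).trans (hEr' ⟨_, _⟩ y hy rfl).symm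

end Glue

section Minimum

variable {E : Type*} [NormedAddCommGroup E] [NormedSpace ℝ E] {F : E → ℝ} {a : E} {ρ c : ℝ}
  {Q : Submodule ℝ E}

theorem IsSaddle.le_apply_of_top (h : IsSaddle F a ρ c ⊤ Q) {z : E} (hz : z ∈ ball a ρ) :
    F a + c / 2 * ‖z - a‖ ^ 2 ≤ F z := by
  simpa using h.le_apply (v := z - a) Submodule.mem_top (by simpa using hz)

/-- A level set slightly above a nondegenerate minimum is parametrized radially by the unit
sphere. -/
theorem IsSaddle.exists_radial [CompleteSpace E] (h : IsSaddle F a ρ c ⊤ Q) {k : ℕ∞ω} (hk : k ≠ 0)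
    (hF : ∀ x ∈ ball a ρ, ContDiffAt ℝ k F x) {w : ℝ} (hw : F a < w)
    (hw' : w < F a + c / 2 * (ρ / 4) ^ 2) :
    ∃ (S : Set E) (τ : E → ℝ), IsOpen S ∧ sphere 0 1 ⊆ S ∧ ContDiffOn ℝ k τ S ∧
      (∀ θ ∈ S, 0 < τ θ ∧ a + τ θ • θ ∈ ball a ρ ∧ F (a + τ θ • θ) = w) ∧
      ∀ z ∈ ball a ρ, F z = w → z ≠ a ∧ τ (‖z - a‖⁻¹ • (z - a)) = ‖z - a‖ := by
  have hρ := h.pos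
  have hc := h.const_pos
  set T := ρ / 2 with hT
  have hT0 : 0 < T := by positivity
  -- An open shell around the sphere, so that `τ` is smooth in the ambient space. Up to time `ρ / 2`
  -- the upper bound keeps rays in the ball, and the lower bound takes them to distance at least `ρ
  -- / 4`, above the level `w`.
  set S : Set E := {θ | 1 / 2 < ‖θ‖ ∧ ‖θ‖ < 2} with hS
  have hSo : IsOpen S := (isOpen_lt continuous_const continuous_norm).inter
    (isOpen_lt continuous_norm continuous_const)
  have hball : ∀ θ ∈ S, ∀ t ∈ Icc 0 T, a + t • θ ∈ ball a ρ := by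
    intro θ hθ t ht
    rw [mem_ball, dist_eq_norm, add_sub_cancel_left, norm_smul, Real.norm_of_nonneg ht.1]
    calc t * ‖θ‖ ≤ T * ‖θ‖ := mul_le_mul_of_nonneg_right ht.2 (norm_nonneg _)
      _ < T * 2 := mul_lt_mul_of_pos_left hθ.2 hT0
      _ = ρ := by rw [hT]; ring
  have hex : ∀ θ ∈ S, ∃ t ∈ Ioo 0 T, F (a + t • θ) = w ∧
      (∀ s ∈ Icc 0 T, s < t → F (a + s • θ) < w) ∧
      ∀ s ∈ Icc 0 T, t < s → w < F (a + s • θ) := by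
    intro θ hθ
    refine exists_crossing_of_convexOn (φ := fun t => F (a + t • θ)) hT0.le
      (h.convexOn_line Submodule.mem_top (hball θ hθ))
      (fun t ht => (hasDerivAt_line (h.differentiableAt _
        (hball θ hθ t ht))).continuousAt.continuousWithinAt) (by simpa using hw) (hw'.trans_le ?_)
    have := h.le_apply_of_top (hball θ hθ T (right_mem_Icc.2 hT0.le))
    rw [add_sub_cancel_left, norm_smul, Real.norm_of_nonneg hT0.le] at this
    refine le_trans ?_ this
    have h1 : ρ / 4 ≤ T * ‖θ‖ := by
      have := mul_le_mul_of_nonneg_left hθ.1.le hT0.le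
      rw [hT] at this ⊢
      linarith
    gcongr
  choose! τ hτ hτw hτlt hτgt using hex
  have hτc : ContinuousOn τ S := by
    rw [continuousOn_iff_continuous_domRestrict]
    refine continuous_crossing (F := fun (θ : S) t => F (a + t • (θ : E)))
      (fun θ => hτ θ θ.2) (fun θ => hτw θ θ.2) (fun θ => hτlt θ θ.2) (fun θ => hτgt θ θ.2)
      fun θ t ht => ?_
    exact ContinuousAt.comp (f := fun θ : S => a + t • (θ : E))
      (hF _ (hball θ θ.2 t (Ioo_subset_Icc_self ht))).continuousAt (by fun_prop)
  refine ⟨S, τ, hSo, fun θ hθ => ?_, fun θ hθ => ?_, fun θ hθ => ⟨(hτ θ hθ).1,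
    hball θ hθ _ (Ioo_subset_Icc_self (hτ θ hθ)), hτw θ hθ⟩, fun z hz hzw => ?_⟩
  · rw [mem_sphere_zero_iff_norm] at hθ
    exact ⟨by rw [hθ]; norm_num, by rw [hθ]; norm_num⟩
  · refine ContDiffAt.contDiffWithinAt ?_
    have hin := hball θ hθ _ (Ioo_subset_Icc_self (hτ θ hθ))
    have hf : ContDiffAt ℝ k (fun p : E × ℝ => F (a + p.2 • p.1)) (θ, τ θ) :=
      ContDiffAt.comp (θ, τ θ) (f := fun p : E × ℝ => a + p.2 • p.1) (hF _ hin) (by fun_prop)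
    refine contDiffAt_of_implicit hk hf ?_ (hτc.continuousAt (hSo.mem_nhds hθ)) ?_
    · have h1 : HasDerivAt (fun s : ℝ => ((θ, s) : E × ℝ)) (0, 1) (τ θ) :=
        (hasDerivAt_const _ _).prodMk (hasDerivAt_id _)
      have h2 := (hf.differentiableAt hk).hasFDerivAt.comp_hasDerivAt _ h1
      rw [h2.unique (hasDerivAt_line (h.differentiableAt _ hin))]
      -- Strict convexity makes the radial derivative nonzero away from `a`, as the implicit
      -- function theorem requires.
      have h3 := h.le_fderiv (v := τ θ • θ) Submodule.mem_top hin
      intro h0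
      rw [map_smul, h0, smul_zero, norm_smul, Real.norm_of_nonneg (hτ θ hθ).1.le] at h3
      have h4 : 0 < c * (τ θ * ‖θ‖) ^ 2 := by
        have := (hτ θ hθ).1
        have : 0 < ‖θ‖ := lt_trans (by norm_num) hθ.1
        positivity
      linarith
    · filter_upwards [hSo.mem_nhds hθ] with y hy
      simp only [hτw y hy, hτw θ hθ]
  · have hza : z ≠ a := by
      rintro rfl
      exact hw.ne hzw
    have hn : 0 < ‖z - a‖ := norm_pos_iff.2 (sub_ne_zero.2 hza)
    refine ⟨hza, ?_⟩
    have hθ : ‖z - a‖⁻¹ • (z - a) ∈ S := by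
      have : ‖‖z - a‖⁻¹ • (z - a)‖ = 1 := by
        rw [norm_smul, norm_inv, norm_norm, inv_mul_cancel₀ hn.ne']
      exact ⟨by rw [this]; norm_num, by rw [this]; norm_num⟩
    have hzθ : a + ‖z - a‖ • ‖z - a‖⁻¹ • (z - a) = z := by
      rw [smul_inv_smul₀ hn.ne']; abel
    have hzT : ‖z - a‖ ∈ Icc 0 T := by
      refine ⟨hn.le, ?_⟩
      have h1 := h.le_apply_of_top hz
      rw [hzw] at h1
      have h2 : c / 2 * ‖z - a‖ ^ 2 < c / 2 * (ρ / 4) ^ 2 := by linarith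
      have h3 := lt_of_pow_lt_pow_left₀ 2 (by positivity) (lt_of_mul_lt_mul_left h2 (by positivity))
      rw [hT]
      linarith
    rcases lt_trichotomy (τ (‖z - a‖⁻¹ • (z - a))) ‖z - a‖ with h' | h' | h'
    · have := hτgt _ hθ _ hzT h'
      rw [hzθ, hzw] at this
      exact absurd this (lt_irrefl _)
    · exact h'
    · have := hτlt _ hθ _ hzT h'
      rw [hzθ, hzw] at this
      exact absurd this (lt_irrefl _)

variable {n : ℕ} {M : Type*} [TopologicalSpace M]
  [ChartedSpace (EuclideanSpace ℝ (Fin n)) M]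

/-- Near a nondegenerate minimum, the level sets slightly above the minimum are spheres. -/
theorem levelSet_inter_chartBall_diffeomorphic [IsManifold (𝓡 n) ∞ M] {k : ℕ∞} (hk : 1 ≤ k)
    {f : M → ℝ} (hf : ContMDiff (𝓡 n) 𝓘(ℝ, ℝ) k f) {p : M} {ρ c : ℝ}
    {Q : Submodule ℝ (EuclideanSpace ℝ (Fin n))}
    (h : IsSaddle (inCoordinates n f p) (extChartAt (𝓡 n) p p) ρ c ⊤ Q)
    (hsub : closedBall (extChartAt (𝓡 n) p p) ρ ⊆ (extChartAt (𝓡 n) p).target) {w : ℝ}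
    (hw : f p < w) (hw' : w < f p + c / 2 * (ρ / 4) ^ 2) :
    SubsetsDiffeomorphic n n k (levelSet f w ∩ chartBall n p ρ) (unitSphere n) := by
  have := isManifold_of_natInf (n := n) (M := M) k
  have hk0 : (k : ℕ∞ω) ≠ 0 := by
    have : k ≠ 0 := fun h0 => by simp [h0] at hk
    exact_mod_cast this
  set φ := extChartAt (𝓡 n) p with hφ
  obtain ⟨S, τ, hSo, hS, hτk, hτS, hτz⟩ := h.exists_radial hk0
    (fun x hx => contDiffAt_inCoordinates hf (hsub (ball_subset_closedBall hx))) (w := w)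
    (by rwa [inCoordinates_self]) (by rwa [inCoordinates_self])
  have hfw : ∀ x ∈ levelSet f w ∩ chartBall n p ρ, inCoordinates n f p (φ x) = w := fun x hx =>
    (inCoordinates_apply hx.2.1).trans hx.1
  have hne : ∀ x ∈ levelSet f w ∩ chartBall n p ρ, 0 < ‖φ x - φ p‖ := fun x hx =>
    norm_pos_iff.2 (sub_ne_zero.2 (hτz _ hx.2.2 (hfw x hx)).1)
  have htarget : ∀ θ ∈ S, φ p + τ θ • θ ∈ φ.target := fun θ hθ =>
    hsub (ball_subset_closedBall (hτS θ hθ).2.1)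
  let e : ↥(levelSet f w ∩ chartBall n p ρ) ≃ unitSphere n :=
    { toFun := fun x => ⟨‖φ x - φ p‖⁻¹ • (φ x - φ p), by
        rw [unitSphere, mem_sphere_zero_iff_norm, norm_smul, norm_inv, norm_norm,
          inv_mul_cancel₀ (hne x x.2).ne']⟩
      invFun := fun θ => ⟨φ.symm (φ p + τ θ • (θ : EuclideanSpace ℝ (Fin n))),
        (hτS θ (hS θ.2)).2.2, φ.map_target (htarget θ (hS θ.2)), by
          rw [mem_preimage, ← hφ, φ.right_inv (htarget θ (hS θ.2))]
          exact (hτS θ (hS θ.2)).2.1⟩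
      left_inv := fun x => by
        refine Subtype.ext ?_
        simp only
        rw [(hτz _ x.2.2.2 (hfw x x.2)).2, smul_inv_smul₀ (hne x x.2).ne', add_sub_cancel,
          φ.left_inv x.2.2.1]
      right_inv := fun θ => by
        refine Subtype.ext ?_
        have h1 : ‖(θ : EuclideanSpace ℝ (Fin n))‖ = 1 := mem_sphere_zero_iff_norm.1 θ.2
        have h2 := (hτS θ (hS θ.2)).1
        simp only
        rw [φ.right_inv (htarget θ (hS θ.2)), add_sub_cancel_left, norm_smul, h1, mul_one,
          Real.norm_of_nonneg h2.le, inv_smul_smul₀ h2.ne'] }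
  refine ⟨e, fun x => ?_, fun θ => ?_⟩
  · refine ⟨φ.source ∩ φ ⁻¹' {φ p}ᶜ, (continuousOn_extChartAt p).isOpen_inter_preimage
      (isOpen_extChartAt_source p) isOpen_compl_singleton, ⟨x.2.2.1, (hτz _ x.2.2.2
      (hfw x x.2)).1⟩, fun y => ‖φ y - φ p‖⁻¹ • (φ y - φ p), ?_, fun y _ => rfl⟩
    have h1 : ContDiffOn ℝ k (fun z => ‖z - φ p‖⁻¹ • (z - φ p)) {φ p}ᶜ := by
      intro z hz
      have hz' : z - φ p ≠ 0 := sub_ne_zero.2 hz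
      have hs : ContDiffAt ℝ k (fun z => z - φ p) z := contDiffAt_id.sub contDiffAt_const
      exact (((hs.norm ℝ hz').inv (norm_ne_zero_iff.2 hz')).smul hs).contDiffWithinAt
    exact h1.contMDiffOn.comp (t := {φ p}ᶜ)
      ((contMDiffOn_extChartAt (x := p)).mono (by simp [hφ])) fun y hy => hy.2
  · refine ⟨S, hSo, hS θ.2, fun θ => φ.symm (φ p + τ θ • θ), ?_, fun y _ => rfl⟩
    have h1 : ContDiffOn ℝ k (fun θ => φ p + τ θ • θ) S :=
      contDiffOn_const.add (hτk.smul contDiffOn_id)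
    exact (contMDiffOn_extChartAt_symm p).comp h1.contMDiffOn htarget

/-- In the chart ball `f ≥ u`, and `f ≥ u + m` outside the quarter ball. So the level `u - ε` misses
the ball, and the level `u + ε` splits into a sphere in the quarter ball and a part outside the
ball. -/
theorem eventually_levelSet_diffeomorphic_disjointUnion [T2Space M] [CompactSpace M]
    [IsManifold (𝓡 n) ∞ M] {k : ℕ∞} (hk : 1 ≤ k)
    {f : M → ℝ} (hf : IsMorse n f) (hfk : ContMDiff (𝓡 n) 𝓘(ℝ, ℝ) k f) {u : ℝ} {p : M}
    (hpu : f p = u) (hp : IsCriticalPoint n f p)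
    (huniq : ∀ q, f q = u → IsCriticalPoint n f q → q = p) (hidx : morseIndex n f p = 0) :
    ∀ᶠ ε in 𝓝[>] (0 : ℝ), SubsetsDiffeomorphic n n k (levelSet f (u + ε))
      (disjointUnion (levelSet f (u - ε)) (unitSphere n)) := by
  have hf1 : ContMDiff (𝓡 n) 𝓘(ℝ, ℝ) 1 f := hf.contMDiff.of_le one_le_two
  have hfc : Continuous f := hf.contMDiff.continuous
  obtain ⟨P, Q, π, ρ, c, hs, hsub, -, -, hP⟩ := hf.exists_isSaddle hp
  obtain rfl := hP hidx
  have hρ := hs.pos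
  have hc := hs.const_pos
  set m := c / 2 * (ρ / 4) ^ 2 with hm
  have hm0 : 0 < m := by positivity
  have hge : ∀ x ∈ chartBall n p ρ, u ≤ f x := by
    intro x hx
    have := hs.le_apply_of_top hx.2
    rw [inCoordinates_self, inCoordinates_apply hx.1, hpu] at this
    refine le_trans ?_ this
    have : 0 ≤ c / 2 * ‖extChartAt (𝓡 n) p x - extChartAt (𝓡 n) p p‖ ^ 2 := by positivity
    linarith
  have hgem : ∀ x ∈ chartBall n p ρ, x ∉ chartClosedBall n p (ρ / 4) → u + m ≤ f x := by
    intro x hx hx'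
    have := hs.le_apply_of_top hx.2
    rw [inCoordinates_self, inCoordinates_apply hx.1, hpu] at this
    refine le_trans ?_ this
    have h1 : ρ / 4 ≤ ‖extChartAt (𝓡 n) p x - extChartAt (𝓡 n) p p‖ := by
      by_contra! hlt
      exact hx' ⟨hx.1, by rw [mem_preimage, mem_closedBall, dist_eq_norm]; exact hlt.le⟩
    rw [hm]
    gcongr
  obtain ⟨η, hη, hband⟩ := exists_band hf1 (u := u) (isOpen_chartBall (n := n) p (ρ / 2))
    fun x hx hc => by
      rw [huniq x hx hc]
      exact mem_chartBall_self p (half_pos hρ)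
  have hcl : IsClosed (chartClosedBall n p (ρ / 4)) :=
    (isCompact_chartClosedBall p ((closedBall_subset_closedBall (by linarith)).trans
      hsub)).isClosed
  -- Requiring `χ = 0` on the closed quarter ball ensures that the swept level `u - ε` does not
  -- enter it.
  obtain ⟨χ, hχ, hχ0, hχ01, ε₂, hε₂, hΦ⟩ := exists_sweep hk hfk
    (s := {x | |f x - u| ≤ η} ∩ (chartBall n p (ρ / 2))ᶜ)
    ((isClosed_le (by fun_prop) continuous_const).inter (isOpen_chartBall p _).isClosed_compl)
    hcl.isOpen_compl (fun x hx hx' => hx.2 (chartClosedBall_subset_chartBall p (by linarith) hx'))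
    fun x hx => hband x hx.1 hx.2
  filter_upwards [Ioo_mem_nhdsGT (show 0 < min (min (η / 3) (m / 3)) (ε₂ / 2) by positivity)]
    with ε hε
  obtain ⟨hε0, hε⟩ := hε
  rw [lt_min_iff, lt_min_iff] at hε
  obtain ⟨⟨hεη, hεm⟩, hε2⟩ := hε
  obtain ⟨Φ, h⟩ := hΦ (2 * ε) (by rw [abs_of_pos (by positivity)]; linarith)
  have hb : ∀ x, 0 ≤ 2 * ε * χ x ∧ 2 * ε * χ x ≤ 2 * ε := fun x =>
    ⟨mul_nonneg (by positivity) (hχ01 x).1, mul_le_of_le_one_right (by positivity) (hχ01 x).2⟩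
  have hout : SubsetsDiffeomorphic n n k (levelSet f (u + ε) ∩ (chartClosedBall n p (ρ / 4))ᶜ)
      (levelSet f (u - ε)) := by
    refine (subsetsDiffeomorphic_of_diffeomorph Φ fun x => ?_).symm
    have hx := h x
    have hbx := hb (Φ x)
    simp only [levelSet, mem_ofPred_eq, mem_inter_iff, mem_compl_iff]
    generalize Φ x = y at *
    rw [← hx]
    constructor
    · intro hy
      have hy1 : y ∉ chartClosedBall n p (ρ / 4) := by
        intro hyB
        rw [hχ0 y (fun h' => h' hyB)] at hy
        have := hge y (chartClosedBall_subset_chartBall p (by linarith) hyB)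
        linarith
      refine ⟨?_, hy1⟩
      have hy2 : y ∉ chartBall n p (ρ / 2) := by
        intro hyB
        have := hgem y (chartBall_subset_chartBall p (by linarith) hyB) hy1
        linarith
      rw [hχ y ⟨by rw [mem_ofPred_eq, abs_le]; constructor <;> linarith, hy2⟩] at hy
      linarith
    · rintro ⟨hy, hy1⟩
      have hy2 : y ∉ chartBall n p (ρ / 2) := by
        intro hyB
        have := hgem y (chartBall_subset_chartBall p (by linarith) hyB) hy1
        linarith
      rw [hχ y ⟨by rw [mem_ofPred_eq, abs_le]; constructor <;> linarith, hy2⟩]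
      linarith
  have hin := levelSet_inter_chartBall_diffeomorphic hk hfk hs hsub (w := u + ε)
    (by linarith) (by rw [hpu]; linarith)
  have hcover : levelSet f (u + ε) = (levelSet f (u + ε) ∩ (chartClosedBall n p (ρ / 4))ᶜ) ∪
      (levelSet f (u + ε) ∩ chartBall n p ρ) := by
    rw [← inter_union_distrib_left, eq_comm, inter_eq_left]
    intro x _
    by_cases hx : x ∈ chartClosedBall n p (ρ / 4)
    · exact Or.inr (chartClosedBall_subset_chartBall p (by linarith) hx)
    · exact Or.inl hx
  have hclhalf : IsClosed (chartClosedBall n p (ρ / 2)) :=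
    (isCompact_chartClosedBall p ((closedBall_subset_closedBall (by linarith)).trans
      hsub)).isClosed
  rw [hcover]
  -- The shell between radii `ρ / 4` and `ρ` carries only values at least `u + m > u + ε`, so radius
  -- `ρ / 2` separates the two parts.
  refine hout.union_disjointUnion hin hclhalf.isOpen_compl (isOpen_chartBall (n := n) p (ρ / 2))
    ?_ ?_ ?_
  · rw [disjoint_left]
    exact fun x hx hx' => hx (chartBall_subset_chartClosedBall p _ hx')
  · rintro x ⟨hx, hx1⟩ hx2
    have hx' : f x = u + ε := hx
    have := hgem x (chartClosedBall_subset_chartBall p (by linarith) hx2) hx1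
    linarith
  · rintro x ⟨hx, hx1⟩
    have hx' : f x = u + ε := hx
    by_contra hx2
    have := hgem x hx1 fun h' => hx2 (chartClosedBall_subset_chartBall p (by linarith) h')
    linarith

end Minimum

end MorseLevel

theorem mainTheorem10 {n : ℕ} {M : Type*} [TopologicalSpace M] [T2Space M] [CompactSpace M]
    [ChartedSpace (EuclideanSpace ℝ (Fin n)) M] [IsManifold (𝓡 n) ∞ M]
    (k : ℕ∞) (hk : 2 ≤ k) (f : M → ℝ) (hf : MorseLevel.IsMorse n f)
    (hfk : ContMDiff (𝓡 n) 𝓘(ℝ, ℝ) k f) :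
    (∀ u v : ℝ, u < v →
      (∀ p : M, MorseLevel.IsCriticalPoint n f p → f p ∉ Set.Icc u v) →
      MorseLevel.SubsetsDiffeomorphic n n k
        (MorseLevel.levelSet f u) (MorseLevel.levelSet f v)) ∧
    (∀ (u : ℝ) (p : M), f p = u → MorseLevel.IsCriticalPoint n f p →
      (∀ q : M, f q = u → MorseLevel.IsCriticalPoint n f q → q = p) →
      (∀ᶠ ε in 𝓝[>] (0 : ℝ),
        Finite (ConnectedComponents (MorseLevel.levelSet f (u + ε))) ∧
        Finite (ConnectedComponents (MorseLevel.levelSet f (u - ε))) ∧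
        |(MorseLevel.b0 (MorseLevel.levelSet f (u + ε)) : ℤ) -
          (MorseLevel.b0 (MorseLevel.levelSet f (u - ε)) : ℤ)| ≤ 6) ∧
      (MorseLevel.morseIndex n f p = 0 →
        ∀ᶠ ε in 𝓝[>] (0 : ℝ),
          MorseLevel.SubsetsDiffeomorphic n n k
            (MorseLevel.levelSet f (u + ε))
            (MorseLevel.disjointUnion (MorseLevel.levelSet f (u - ε))
              (MorseLevel.unitSphere n)))) := by

  have hk1 : 1 ≤ k := le_trans one_le_two hk
  refine ⟨fun u v huv hcrit => MorseLevel.levelSet_diffeomorphic hk1 hfk huv.le hcrit,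
    fun u p hpu hp huniq => ⟨?_, fun hidx =>
      MorseLevel.eventually_levelSet_diffeomorphic_disjointUnion hk1 hf hfk hpu hp huniq hidx⟩⟩
  filter_upwards [MorseLevel.eventually_abs_b0_sub_le hf hpu hp huniq] with ε hε
  exact ⟨hε.1, hε.2.1, hε.2.2.trans (by norm_num)⟩
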